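/- **Setting.** Let $V$ be an oriented real $6$-dimensional vector space. A $3$-form $\rho\in\Lambda^3V^*$ is called *definite* if for each non-zero $v\in V$ the $2$-form $i_v\rho$ has rank $4$; then $N_v=\{v'\in V: i_{v'}i_v\rho=0\}$ is $2$-dimensional, and for each non-zero $v'\in N_v$ the form $i_{v'}\rho$ induces a symplectic form $\Omega_{v'}$ on $V/N_v$. Orient $V/N_v$ so that $\Omega_{v'}^2>0$, give $N_v$ the orientation induced by those of $V$ and $V/N_v$, and the conformal structure $v'\mapsto\Omega_{v'}^2$. The complex structure $I_\rho$ on $V$ is defined by letting $I_\rho(v)\in N_v$ be the rotation of $v$ by $+90^\circ$ in $N_v$, and $\tilde\rho\in\Lambda^3V^*$ is the real $3$-form characterised by $\rho+i\tilde\rho$ being of type $(3,0)$ with respect to $I_\rho$. **Lemma 1.** Let $N$ be a smooth oriented $6$-manifold and let $\rho$ be a closed $SL(3,\mathbb C)$-structure on $N$, i.e. a smooth $3$-form that is definite at each point and satisfies $d\rho=0$. Then $I_\rho$ (with $I_\rho^2=-1$) and $\tilde\rho$ are well defined, that is, they exist and are unique at each point, $\tilde\rho$ is a smooth $3$-form on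 $N$, and the $4$-form $d\tilde\rho$ has type $(2,2)$ with respect to the almost-complex structure $I_\rho$. -/

import Mathlib

open scoped Manifold ContDiff Topology

noncomputable section

namespace SL3

/-! ### Linear algebra of `3`-forms on a real vector space -/

section Linear

theorem update_one {V : Type*} (v a b c : V) : Function.update ![v, a, b] 1 c = ![v, c, b] := by
  ext i; fin_cases i <;> rfl

theorem update_two {V : Type*} (v a b c : V) : Function.update ![v, a, b] 2 c = ![v, a, c] := by
  ext i; fin_cases i <;> rfl

variable {V : Type*} [AddCommGroup V] [Module ℝ V] [TopologicalSpace V]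

/-- The contraction `i_v ρ` of a `3`-form, as the bilinear form `(a, b) ↦ ρ (v, a, b)`. -/
def contract (ρ : V [⋀^Fin 3]→L[ℝ] ℝ) (v : V) : V →ₗ[ℝ] V →ₗ[ℝ] ℝ :=
  LinearMap.mk₂ ℝ (fun a b => ρ ![v, a, b])
    (fun a a' b => by simpa only [update_one] using ρ.map_update_add ![v, a, b] 1 a a')
    (fun c a b => by simpa only [update_one] using ρ.map_update_smul ![v, a, b] 1 c a)
    (fun a b b' => by simpa only [update_two] using ρ.map_update_add ![v, a, b] 2 b b')
    (fun c a b => by simpa only [update_two] using ρ.map_update_smul ![v, a, b] 2 c b)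

/-- A `3`-form `ρ` (on a `6`-dimensional space) is definite if for each non-zero `v` the `2`-form
`i_v ρ` has rank `4`. -/
def IsDefinite (ρ : V [⋀^Fin 3]→L[ℝ] ℝ) : Prop :=
  ∀ v : V, v ≠ 0 → Module.finrank ℝ (LinearMap.range (contract ρ v)) = 4

/-- The null space `N_v = {v' | i_{v'} i_v ρ = 0}`. -/
def nullSpace (ρ : V [⋀^Fin 3]→L[ℝ] ℝ) (v : V) : Submodule ℝ V :=
  LinearMap.ker (contract ρ v)

/-- The value `(α ∧ β) (a, b, c, d)` of the wedge product of two `2`-forms. -/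
def wedge₂ (α β : V →ₗ[ℝ] V →ₗ[ℝ] ℝ) (a b c d : V) : ℝ :=
  α a b * β c d - α a c * β b d + α a d * β b c
    + α b c * β a d - α b d * β a c + α c d * β a b

/-- `w` is obtained from `v` by the rotation by `+90°` in the oriented conformal plane `N_v`.
The conformal structure on `N_v` is `v' ↦ Ω_{v'}²`, where `Ω_{v'}` is the form on `V / N_v`
induced by `i_{v'} ρ`; the forms on `V / N_v` are identified with their pull-backs to `V`.
The quotient `V / N_v` is oriented by `Ω_v² > 0`, and `N_v` is oriented so that the orientation
of `V` is the one of `N_v ⊕ V / N_v`. -/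
structure IsQuarterTurn (o : Orientation ℝ V (Fin 6)) (ρ : V [⋀^Fin 3]→L[ℝ] ℝ)
    (v w : V) : Prop where
  /-- `w` lies in `N_v`. -/
  mem : w ∈ nullSpace ρ v
  /-- `v` and `w` are orthogonal. -/
  orthogonal : ∀ a b c d : V, wedge₂ (contract ρ v) (contract ρ w) a b c d = 0
  /-- `v` and `w` have the same length. -/
  same_length : ∀ a b c d : V,
    wedge₂ (contract ρ w) (contract ρ w) a b c d = wedge₂ (contract ρ v) (contract ρ v) a b c d
  /-- `(v, w)` is a positively oriented basis of `N_v`. -/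
  oriented : ∀ a b c d : V, 0 < wedge₂ (contract ρ v) (contract ρ v) a b c d →
    ∃ B : Module.Basis (Fin 6) ℝ V, ⇑B = ![v, w, a, b, c, d] ∧ B.orientation = o

/-- `J` is the complex structure induced by the definite form `ρ` and the orientation `o`:
for each non-zero `v`, `J v` is the quarter turn of `v` in the plane `N_v`. -/
def IsInducedComplexStructure (o : Orientation ℝ V (Fin 6)) (ρ : V [⋀^Fin 3]→L[ℝ] ℝ)
    (J : V →ₗ[ℝ] V) : Prop :=
  ∀ v : V, v ≠ 0 → IsQuarterTurn o ρ v (J v)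

open Classical in
/-- The complex structure `I_ρ` induced by a definite form `ρ` and an orientation
(`0` if there is none, which does not happen for definite forms in dimension `6`). -/
def inducedComplexStructure (o : Orientation ℝ V (Fin 6)) (ρ : V [⋀^Fin 3]→L[ℝ] ℝ) :
    V →ₗ[ℝ] V :=
  if h : ∃ J : V →ₗ[ℝ] V, IsInducedComplexStructure o ρ J then h.choose else 0

/-- The value `α (x₁ + i y₁, …, x_k + i y_k)` of the complex multilinear extension to `V ⊗ ℂ` of
a complex-valued `k`-form `α` on `V`. -/
def complexEval {k : ℕ} (α : V [⋀^Fin k]→L[ℝ] ℂ) (x y : Fin k → V) : ℂ :=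
  ∑ S : Finset (Fin k), Complex.I ^ S.card * α (fun j => if j ∈ S then y j else x j)

/-- A complex-valued `k`-form `α` is of type `(p, q)`, `p + q = k`, with respect to the complex
structure `J`, if its complex multilinear extension vanishes on each `k`-tuple made of vectors
`x - i J x` of type `(1, 0)` (the slots in `S`) and vectors `x + i J x` of type `(0, 1)`
(the other slots), unless exactly `p` of them are of type `(1, 0)`. -/
def IsOfType {k : ℕ} (p q : ℕ) (J : V →ₗ[ℝ] V) (α : V [⋀^Fin k]→L[ℝ] ℂ) : Prop :=
  p + q = k ∧ ∀ (x : Fin k → V) (S : Finset (Fin k)), S.card ≠ p →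
    complexEval α x (fun j => if j ∈ S then -J (x j) else J (x j)) = 0

/-- A real form regarded as a complex-valued form. -/
def complexify {k : ℕ} (α : V [⋀^Fin k]→L[ℝ] ℝ) : V [⋀^Fin k]→L[ℝ] ℂ :=
  Complex.ofRealCLM.compContinuousAlternatingMap α

/-- `σ` is the form `ρ̃` for the complex structure `J`: `ρ + i σ` is of type `(3, 0)`. -/
def IsConjugate [IsTopologicalAddGroup V] [ContinuousConstSMul ℝ V] (J : V →ₗ[ℝ] V)
    (ρ σ : V [⋀^Fin 3]→L[ℝ] ℝ) : Prop :=
  IsOfType 3 0 J (complexify ρ + Complex.I • complexify σ)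

open Classical in
/-- The `3`-form `ρ̃` characterised by the fact that `ρ + i ρ̃` is of type `(3, 0)` with respect to
`I_ρ` (`0` if there is none, which does not happen for definite forms in dimension `6`). -/
def conjugateForm [IsTopologicalAddGroup V] [ContinuousConstSMul ℝ V]
    (o : Orientation ℝ V (Fin 6)) (ρ : V [⋀^Fin 3]→L[ℝ] ℝ) : V [⋀^Fin 3]→L[ℝ] ℝ :=
  if h : ∃ σ, IsConjugate (inducedComplexStructure o ρ) ρ σ then h.choose else 0

end Linear

/-! ### Differential forms and orientations on a `6`-manifold -/

/-- The model space `ℝ⁶`. -/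
abbrev R6 : Type := EuclideanSpace ℝ (Fin 6)

section Manifold

variable {N : Type*} [TopologicalSpace N] [ChartedSpace R6 N]

variable (N) in
/-- Differential `k`-forms on `N` (with no regularity). -/
abbrev DForm (k : ℕ) : Type _ := ∀ x : N, TangentSpace (𝓡 6) x [⋀^Fin k]→L[ℝ] ℝ

/-- The expression of a form in the preferred chart at `x₀`, i.e. its pull-back by the inverse of
the chart; it is meaningful on the target of the chart. -/
def DForm.inChart {k : ℕ} (α : DForm N k) (x₀ : N) (y : R6) : R6 [⋀^Fin k]→L[ℝ] ℝ :=
  (α ((extChartAt (𝓡 6) x₀).symm y)).compContinuousLinearMap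
    (mfderiv 𝓘(ℝ, R6) (𝓡 6) (extChartAt (𝓡 6) x₀).symm y)

/-- A form is smooth if its expressions in charts are. -/
def DForm.IsSmooth {k : ℕ} (α : DForm N k) : Prop :=
  ∀ x₀ : N, ContDiffOn ℝ ∞ (DForm.inChart α x₀) (extChartAt (𝓡 6) x₀).target

/-- The exterior derivative of a form, computed at `x` in the preferred chart at `x`. -/
def DForm.d {k : ℕ} (α : DForm N k) : DForm N (k + 1) := fun x =>
  (extDeriv (DForm.inChart α x) (extChartAt (𝓡 6) x x)).compContinuousLinearMap
    (mfderiv (𝓡 6) 𝓘(ℝ, R6) (extChartAt (𝓡 6) x) x)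

variable [IsManifold (𝓡 6) ∞ N]

/-- The linear isomorphism `T_y N ≃ ℝ⁶` given by the trivialization of the tangent bundle over
the domain of the preferred chart at `x₀` (the derivative of this chart at `y`). -/
def tangentCoord (x₀ y : N)
    (hy : y ∈ (trivializationAt R6 (TangentSpace (𝓡 6) : N → Type _) x₀).baseSet) :
    TangentSpace (𝓡 6) y ≃ₗ[ℝ] R6 :=
  haveI : IsManifold (𝓡 6) 1 N := IsManifold.of_le (n := ∞) (by simp)
  ((trivializationAt R6 (TangentSpace (𝓡 6) : N → Type _) x₀).continuousLinearEquivAt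
    ℝ y hy).toLinearEquiv

variable (N) in
/-- An orientation of the manifold `N`: orientations of the tangent spaces that are locally
constant in the coordinates given by charts. -/
structure ManifoldOrientation where
  /-- The orientation of each tangent space. -/
  at_ : ∀ x : N, Orientation ℝ (TangentSpace (𝓡 6) x) (Fin 6)
  /-- Around each point, the orientation is constant in the coordinates of a chart. -/
  locally_constant : ∀ x₀ : N, ∃ c : Orientation ℝ R6 (Fin 6), ∀ᶠ y in 𝓝 x₀,
    ∀ hy : y ∈ (trivializationAt R6 (TangentSpace (𝓡 6) : N → Type _) x₀).baseSet,
      Orientation.map (Fin 6) (tangentCoord x₀ y hy) (at_ y) = c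

/-- A closed `SL(3, ℂ)`-structure: a smooth `3`-form that is definite at each point and closed. -/
structure IsClosedSLStructure (ρ : DForm N 3) : Prop where
  smooth : DForm.IsSmooth ρ
  definite : ∀ x, IsDefinite (ρ x)
  closed : ∀ x, DForm.d ρ x = 0

/-- The almost-complex structure `I_ρ`. -/
def almostComplexStructure (o : ManifoldOrientation N) (ρ : DForm N 3) (x : N) :
    TangentSpace (𝓡 6) x →ₗ[ℝ] TangentSpace (𝓡 6) x :=
  inducedComplexStructure (o.at_ x) (ρ x)

/-- The `3`-form `ρ̃` on `N`. -/
def tildeForm (o : ManifoldOrientation N) (ρ : DForm N 3) : DForm N 3 := fun x =>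
  conjugateForm (o.at_ x) (ρ x)

end Manifold

end SL3

end

noncomputable section

namespace SL3

/-! ### Contractions of a 3-form and the 5-form `i_v ρ ∧ ρ`. -/

section Linear

variable {V : Type*} [AddCommGroup V] [Module ℝ V] [TopologicalSpace V]

/-! Pointwise, everything is read off from Hitchin's endomorphism `K`, defined by `2 i_v ρ ∧ ρ =
i_{Kv} vol`. Contracting with `x ∈ N_v` gives `2 i_v ρ ∧ i_x ρ = vol(Kv, x, ·)`
(`two_mul_wedge₂_eq_det`). For `x = v` the left side is non-zero by definiteness, so `Kv` and `v`
span `N_v`; for `x = Kv` it shows that `Kv` is orthogonal to `v`. Applying the same identity at `Kv`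
gives `K²v = s v`, and definiteness forces `s < 0`. Hence `K² = -c` with a constant `c > 0`, and
`I_ρ = -K / √c`. This formula gives existence, and smooth dependence on `ρ`; uniqueness holds
because a quarter turn in an oriented conformal plane is determined.

Polarising `I v ∈ N_v` gives `ρ(Ix, y, z) = ρ(x, Iy, z)`. So `ρ̃ = -ρ(I·, ·, ·)` is alternating, and
it is the only form for which `Θ = ρ + iρ̃` has type `(3,0)`.

For the type of `dρ̃`, work in a chart near `p` and write `I_q` for the structure at `q`. For fixed
vectors, `Θ_q(x + i I_p x, y + i I_p y, z)` equals `-Θ_q((I_p - I_q)x, (I_p - I_q)y, z)`, which is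
quadratically small in `q - p`. Thus a first derivative of `Θ` at `p` vanishes on any two `(0,1)`
arguments. Each term of `dΘ` with three `(0,1)` arguments still has two of them inside `Θ`, so `dΘ =
i dρ̃` (as `dρ = 0`) has no `(1,3)` or `(0,4)` part. Complex conjugation removes `(3,1)` and
`(4,0)`. No integrability of `I_ρ` is needed. -/

theorem contract_apply (ρ : V [⋀^Fin 3]→L[ℝ] ℝ) (v a b : V) : contract ρ v a b = ρ ![v, a, b] :=
  rfl

theorem contract_swap (ρ : V [⋀^Fin 3]→L[ℝ] ℝ) (v a b : V) :
    contract ρ v a b = -contract ρ v b a := by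
  have h := ρ.toAlternatingMap.map_swap ![v, b, a] (i := 1) (j := 2) (by decide)
  have e : ![v, b, a] ∘ Equiv.swap (1 : Fin 3) 2 = ![v, a, b] := by
    ext i; fin_cases i <;> rfl
  rw [e] at h
  exact h

theorem contract_swap_left (ρ : V [⋀^Fin 3]→L[ℝ] ℝ) (v a b : V) :
    contract ρ v a b = -contract ρ a v b := by
  have h := ρ.toAlternatingMap.map_swap ![a, v, b] (i := 0) (j := 1) (by decide)
  have e : ![a, v, b] ∘ Equiv.swap (0 : Fin 3) 1 = ![v, a, b] := by
    ext i; fin_cases i <;> rfl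
  rw [e] at h
  exact h

theorem contract_self (ρ : V [⋀^Fin 3]→L[ℝ] ℝ) (v a : V) : contract ρ v a a = 0 := by
  linarith [contract_swap ρ v a a]

theorem contract_self_left (ρ : V [⋀^Fin 3]→L[ℝ] ℝ) (v a : V) : contract ρ v v a = 0 := by
  linarith [contract_swap_left ρ v v a]

/-- The contraction `v ↦ i_v ρ` as a linear map. -/
def contractₗ (ρ : V [⋀^Fin 3]→L[ℝ] ℝ) : V →ₗ[ℝ] V →ₗ[ℝ] V →ₗ[ℝ] ℝ where
  toFun := contract ρ
  map_add' v w := by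
    ext a b
    simp only [LinearMap.add_apply]
    rw [contract_swap_left, contract_swap_left ρ v, contract_swap_left ρ w, map_add,
      LinearMap.add_apply]
    ring
  map_smul' c v := by
    ext a b
    simp only [LinearMap.smul_apply, RingHom.id_apply]
    rw [contract_swap_left, contract_swap_left ρ v, map_smul, LinearMap.smul_apply, smul_neg]

theorem contract_add (ρ : V [⋀^Fin 3]→L[ℝ] ℝ) (v w : V) :
    contract ρ (v + w) = contract ρ v + contract ρ w :=
  (contractₗ ρ).map_add v w

theorem contract_smul (ρ : V [⋀^Fin 3]→L[ℝ] ℝ) (c : ℝ) (v : V) :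
    contract ρ (c • v) = c • contract ρ v :=
  (contractₗ ρ).map_smul c v

theorem contract_neg (ρ : V [⋀^Fin 3]→L[ℝ] ℝ) (v : V) : contract ρ (-v) = -contract ρ v :=
  map_neg (contractₗ ρ) v

theorem contract_sub (ρ : V [⋀^Fin 3]→L[ℝ] ℝ) (v w : V) :
    contract ρ (v - w) = contract ρ v - contract ρ w :=
  map_sub (contractₗ ρ) v w

/-- The `5`-form `2 i_v ρ ∧ ρ`, as a linear function of `v`. -/
def contractWedge (ρ : V [⋀^Fin 3]→L[ℝ] ℝ) : V →ₗ[ℝ] V [⋀^Fin 5]→ₗ[ℝ] ℝ :=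
  AlternatingMap.alternatizeUncurryFinLM ∘ₗ
    LinearMap.compRight ℝ (AlternatingMap.alternatizeUncurryFinLM ∘ₗ
      LinearMap.smulRightₗ.flip ρ.toAlternatingMap) ∘ₗ contractₗ ρ

theorem contractWedge_apply (ρ : V [⋀^Fin 3]→L[ℝ] ℝ) (v : V) (x : Fin 5 → V) :
    contractWedge ρ v x = ∑ i : Fin 5, (-1) ^ (i : ℕ) * ∑ j : Fin 4, (-1) ^ (j : ℕ) *
      (ρ ![v, x i, i.removeNth x j] * ρ (j.removeNth (i.removeNth x))) := by
  simp [contractWedge, AlternatingMap.alternatizeUncurryFinLM,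
    AlternatingMap.alternatizeUncurryFin_apply, contractₗ, contract_apply]

/-- Contraction with `x` is an antiderivation and `i_x i_v ρ = 0`, so only `i_v ρ ∧ i_x ρ` survives.
The factor 2 arises because the double alternatization counts each pair of arguments of `i_v ρ` in
both orders. -/
theorem contractWedge_of_mem_nullSpace (ρ : V [⋀^Fin 3]→L[ℝ] ℝ) {v x : V}
    (hx : x ∈ nullSpace ρ v) (a b c d : V) :
    contractWedge ρ v ![x, a, b, c, d] = 2 * wedge₂ (contract ρ v) (contract ρ x) a b c d := by
  have h0 : ∀ y, contract ρ v x y = 0 := fun y => by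
    rw [show contract ρ v x = 0 from hx]; rfl
  have h1 : ∀ y, contract ρ v y x = 0 := fun y => by rw [contract_swap, h0, neg_zero]
  have e : ∀ y : Fin 3 → V, ρ y = contract ρ (y 0) (y 1) (y 2) := fun y => by
    rw [contract_apply]; congr 1; ext i; fin_cases i <;> rfl
  rw [contractWedge_apply]
  simp only [Fin.sum_univ_succ, e]
  simp [Fin.removeNth, Fin.succAbove, Fin.lt_def, h0, h1, wedge₂]
  rw [contract_swap ρ v b a, contract_swap ρ v c a, contract_swap ρ v d a, contract_swap ρ v c b,
    contract_swap ρ v d b, contract_swap ρ v d c]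
  ring

end Linear

/-! ### The endomorphism `K` and the rank of `i_v ρ`. -/

section Linear

/-- In dimension `6` each `5`-form `F` is the contraction of the volume form of a basis `e` with
an explicit vector. -/
theorem alternating_five_eq_det {V : Type*} [AddCommGroup V] [Module ℝ V]
    (e : Module.Basis (Fin 6) ℝ V) (F : V [⋀^Fin 5]→ₗ[ℝ] ℝ) (x : Fin 5 → V) :
    F x = e.det (Matrix.vecCons
      (∑ i : Fin 6, ((-1) ^ (i : ℕ) * F (i.removeNth e)) • e i) x) := by
  set u := ∑ i : Fin 6, ((-1) ^ (i : ℕ) * F (i.removeNth e)) • e i with hu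
  -- The 6-form `ξ ∧ F` is a multiple of the determinant; evaluating on `e` shows that the factor is
  -- `ξ u`.
  have key : ∀ ξ : V →ₗ[ℝ] ℝ, ∀ y : Fin 6 → V,
      ∑ i : Fin 6, (-1) ^ (i : ℕ) * (ξ (y i) * F (i.removeNth y)) = ξ u * e.det y := by
    intro ξ y
    have h := (AlternatingMap.alternatizeUncurryFin (ξ.smulRight F)).eq_smul_basis_det e
    have h' := congrArg (fun G : V [⋀^Fin 6]→ₗ[ℝ] ℝ => G y) h
    simp only [AlternatingMap.smul_apply, AlternatingMap.alternatizeUncurryFin_apply,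
      LinearMap.smulRight_apply, smul_eq_mul] at h'
    have h2 : ξ u = ∑ i : Fin 6, (-1) ^ (i : ℕ) • (ξ (e i) * F (i.removeNth e)) := by
      rw [hu, map_sum]
      refine Finset.sum_congr rfl fun i _ => ?_
      rw [map_smul, smul_eq_mul]
      rcases Nat.even_or_odd (i : ℕ) with h | h <;> simp [h.neg_one_pow] <;> ring
    rw [h2, ← h']
    refine Finset.sum_congr rfl fun i _ => ?_
    rcases Nat.even_or_odd (i : ℕ) with h | h <;> simp [h.neg_one_pow]
  by_cases hx : LinearIndependent ℝ x
  · have : Module.Finite ℝ V := .of_basis e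
    have hfr : Module.finrank ℝ V = 6 := by simpa using Module.finrank_eq_card_basis e
    have hspan : Submodule.span ℝ (Set.range x) ≠ ⊤ := by
      intro h
      have h1 := finrank_span_eq_card hx
      rw [h, finrank_top, hfr] at h1
      simp at h1
    obtain ⟨y₀, hy₀⟩ : ∃ y₀, y₀ ∉ Submodule.span ℝ (Set.range x) := by
      by_contra! h
      exact hspan (eq_top_iff.2 fun z _ => h z)
    have hli : LinearIndependent ℝ (Matrix.vecCons y₀ x : Fin 6 → V) :=
      linearIndependent_finCons.2 ⟨hx, hy₀⟩
    have hdet : e.det (Matrix.vecCons y₀ x) ≠ 0 := by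
      have := (e.is_basis_iff_det (v := Matrix.vecCons y₀ x)).1
        ⟨hli, hli.span_eq_top_of_card_eq_finrank' (by simp [hfr])⟩
      exact this.ne_zero
    -- This covector kills every `x i`, so for `y = (y₀, x)` the sum in `key` reduces to its first
    -- term, and `ξ y₀` cancels against the determinant.
    let ξ : V →ₗ[ℝ] ℝ :=
      { toFun := fun z => e.det.curryLeft z x
        map_add' := fun z z' => by rw [map_add, AlternatingMap.add_apply]
        map_smul' := fun c z => by rw [map_smul, AlternatingMap.smul_apply, RingHom.id_apply] }
    have hξ : ∀ z, ξ z = e.det (Matrix.vecCons z x) := fun z =>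
      AlternatingMap.curryLeft_apply_apply e.det z x
    have hξx : ∀ i, ξ (x i) = 0 := fun i => by
      rw [hξ]
      exact e.det.map_eq_zero_of_eq _ (i := 0) (j := i.succ) (by simp) (Fin.succ_ne_zero i).symm
    have hk := key ξ (Matrix.vecCons y₀ x)
    rw [Fin.sum_univ_succ] at hk
    simp only [Matrix.cons_val_succ, hξx, zero_mul, mul_zero, Finset.sum_const_zero, add_zero,
      Matrix.cons_val_zero, Fin.val_zero, pow_zero, one_mul] at hk
    have hr : Fin.removeNth 0 (Matrix.vecCons y₀ x : Fin 6 → V) = x := by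
      ext j; simp [Fin.removeNth]
    rw [hr, hξ, hξ, mul_comm] at hk
    exact mul_right_cancel₀ hdet hk
  · rw [F.map_linearDependent _ hx, AlternatingMap.map_linearDependent]
    intro h
    exact hx (linearIndependent_finCons.1 h).1

variable {V : Type*} [AddCommGroup V] [Module ℝ V] [TopologicalSpace V]

/-- The endomorphism `K` with `2 i_v ρ ∧ ρ = i_{K v} vol`, where `vol` is the volume form of the
basis `e`. -/
def hitchinMap (e : Module.Basis (Fin 6) ℝ V) (ρ : V [⋀^Fin 3]→L[ℝ] ℝ) : V →ₗ[ℝ] V where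
  toFun v := ∑ i : Fin 6, ((-1) ^ (i : ℕ) * contractWedge ρ v (i.removeNth e)) • e i
  map_add' v w := by
    simp only [map_add, AlternatingMap.add_apply, mul_add, add_smul, Finset.sum_add_distrib]
  map_smul' c v := by
    simp only [map_smul, AlternatingMap.smul_apply, smul_eq_mul, RingHom.id_apply,
      Finset.smul_sum, smul_smul]
    exact Finset.sum_congr rfl fun i _ => by congr 1; ring

theorem hitchinMap_apply (e : Module.Basis (Fin 6) ℝ V) (ρ : V [⋀^Fin 3]→L[ℝ] ℝ) (v : V) :
    hitchinMap e ρ v = ∑ i : Fin 6, ((-1) ^ (i : ℕ) * contractWedge ρ v (i.removeNth e)) • e i :=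
  rfl

theorem two_mul_wedge₂_eq_det (e : Module.Basis (Fin 6) ℝ V) (ρ : V [⋀^Fin 3]→L[ℝ] ℝ) {v x : V}
    (hx : x ∈ nullSpace ρ v) (a b c d : V) :
    2 * wedge₂ (contract ρ v) (contract ρ x) a b c d =
      e.det ![hitchinMap e ρ v, x, a, b, c, d] := by
  rw [← contractWedge_of_mem_nullSpace ρ hx, alternating_five_eq_det e]
  rfl

theorem mem_nullSpace_iff {ρ : V [⋀^Fin 3]→L[ℝ] ℝ} {v w : V} :
    w ∈ nullSpace ρ v ↔ ∀ a, contract ρ v w a = 0 :=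
  ⟨fun h a => by rw [show contract ρ v w = 0 from h]; rfl, fun h => LinearMap.ext h⟩

theorem self_mem_nullSpace (ρ : V [⋀^Fin 3]→L[ℝ] ℝ) (v : V) : v ∈ nullSpace ρ v :=
  mem_nullSpace_iff.2 fun a => contract_self_left ρ v a

theorem mem_nullSpace_comm {ρ : V [⋀^Fin 3]→L[ℝ] ℝ} {v w : V} (h : w ∈ nullSpace ρ v) :
    v ∈ nullSpace ρ w :=
  mem_nullSpace_iff.2 fun a => by rw [contract_swap_left, mem_nullSpace_iff.1 h, neg_zero]

theorem contract_of_mem_nullSpace_left {ρ : V [⋀^Fin 3]→L[ℝ] ℝ} {v w : V}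
    (h : w ∈ nullSpace ρ v) (a : V) : contract ρ v w a = 0 :=
  mem_nullSpace_iff.1 h a

theorem contract_of_mem_nullSpace_right {ρ : V [⋀^Fin 3]→L[ℝ] ℝ} {v w : V}
    (h : w ∈ nullSpace ρ v) (a : V) : contract ρ v a w = 0 := by
  rw [contract_swap, mem_nullSpace_iff.1 h, neg_zero]

theorem finrank_nullSpace {ρ : V [⋀^Fin 3]→L[ℝ] ℝ} (hρ : IsDefinite ρ)
    (e : Module.Basis (Fin 6) ℝ V) {v : V} (hv : v ≠ 0) :
    Module.finrank ℝ (nullSpace ρ v) = 2 := by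
  have : Module.Finite ℝ V := .of_basis e
  have hfr : Module.finrank ℝ V = 6 := by simpa using Module.finrank_eq_card_basis e
  have h := (contract ρ v).finrank_range_add_finrank_ker
  rw [hρ v hv, hfr] at h
  unfold nullSpace
  omega

/-- A 2-form of rank 4 has non-zero square: split off a hyperbolic pair `a, b`, then find another
pair `c, d` with `c` in the complement of the first. Exchanging `a` and `b` adjusts the sign. -/
theorem exists_wedge₂_self_pos {ρ : V [⋀^Fin 3]→L[ℝ] ℝ} (hρ : IsDefinite ρ)
    (e : Module.Basis (Fin 6) ℝ V) {v : V} (hv : v ≠ 0) :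
    ∃ a b c d, 0 < wedge₂ (contract ρ v) (contract ρ v) a b c d := by
  have : Module.Finite ℝ V := .of_basis e
  have hfr : Module.finrank ℝ V = 6 := by simpa using Module.finrank_eq_card_basis e
  have hN := finrank_nullSpace hρ e hv
  suffices h : ∃ a b c d, wedge₂ (contract ρ v) (contract ρ v) a b c d ≠ 0 by
    obtain ⟨a, b, c, d, h⟩ := h
    rcases h.lt_or_gt with h | h
    · refine ⟨b, a, c, d, ?_⟩
      have : wedge₂ (contract ρ v) (contract ρ v) b a c d =
          -wedge₂ (contract ρ v) (contract ρ v) a b c d := by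
        simp only [wedge₂]
        rw [contract_swap ρ v b a]
        ring
      linarith
    · exact ⟨a, b, c, d, h⟩
  obtain ⟨a, ha⟩ : ∃ a, a ∉ nullSpace ρ v := by
    by_contra! h
    have htop : nullSpace ρ v = ⊤ := eq_top_iff.2 fun x _ => h x
    rw [htop, finrank_top, hfr] at hN
    omega
  obtain ⟨b, hb⟩ : ∃ b, contract ρ v a b ≠ 0 := by
    by_contra! h
    exact ha (mem_nullSpace_iff.2 h)
  set t := contract ρ v a b with ht
  -- Otherwise the projection along `a, b` would send everything into `N_v`, giving `6 ≤ 2 + 2`.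
  have hproj : ∃ c, contract ρ v a c = 0 ∧ contract ρ v b c = 0 ∧ c ∉ nullSpace ρ v := by
    by_contra! h
    have hle : (⊤ : Submodule ℝ V) ≤ nullSpace ρ v ⊔ Submodule.span ℝ {a, b} := by
      intro x _
      have hx : x - (contract ρ v a x / t) • b + (contract ρ v b x / t) • a ∈ nullSpace ρ v := by
        apply h
        · simp only [map_add, map_sub, map_smul, smul_eq_mul, contract_self, ← ht]
          field_simp
          ring
        · simp only [map_add, map_sub, map_smul, smul_eq_mul, contract_self,
            contract_swap ρ v b a, ← ht]
          field_simp
          ring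
      rw [show x = (x - (contract ρ v a x / t) • b + (contract ρ v b x / t) • a) +
        ((contract ρ v a x / t) • b - (contract ρ v b x / t) • a) by abel]
      refine Submodule.add_mem_sup hx (Submodule.sub_mem _ ?_ ?_) <;>
        exact Submodule.smul_mem _ _ (Submodule.subset_span (by simp))
    have h1 := Submodule.finrank_mono hle
    have h2 := Submodule.finrank_add_le_finrank_add_finrank (nullSpace ρ v)
      (Submodule.span ℝ {a, b})
    have h3 : Module.finrank ℝ (Submodule.span ℝ ({a, b} : Set V)) ≤ 2 := by
      classical
      have := finrank_span_finset_le_card (R := ℝ) ({a, b} : Finset V)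
      simp only [Finset.coe_insert, Finset.coe_singleton] at this
      exact this.trans Finset.card_le_two
    rw [finrank_top, hfr] at h1
    omega
  obtain ⟨c, hac, hbc, hc⟩ := hproj
  obtain ⟨d, hd⟩ : ∃ d, contract ρ v c d ≠ 0 := by
    by_contra! h
    exact hc (mem_nullSpace_iff.2 h)
  refine ⟨a, b, c, d, ?_⟩
  have : wedge₂ (contract ρ v) (contract ρ v) a b c d = 2 * (t * contract ρ v c d) := by
    simp only [wedge₂, hac, hbc, ← ht]
    ring
  rw [this]
  positivity

end Linear

/-! ### `K` preserves the planes `N_v`, and `K²` is negative on each of them. -/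

section Linear

theorem alternating_update_basis {ι V : Type*} [Fintype ι] [DecidableEq ι] [AddCommGroup V]
    [Module ℝ V] (f : V [⋀^ι]→ₗ[ℝ] ℝ) (b : Module.Basis ι ℝ V) (i : ι) (y : V) :
    f (Function.update b i y) = b.repr y i * f b := by
  have h : f.toMultilinearMap.toLinearMap b i = f b • b.coord i := by
    refine b.ext fun j => ?_
    rcases eq_or_ne i j with rfl | hij
    · simp
    · simp [f.map_update_self _ hij, Finsupp.single_eq_of_ne hij]
  have h' := congrArg (fun g : V →ₗ[ℝ] ℝ => g y) h
  simpa [mul_comm] using h'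

variable {V : Type*} [AddCommGroup V] [Module ℝ V]

theorem det_cons_linear_comb (e : Module.Basis (Fin 6) ℝ V) (s t : ℝ) (x y : V) (m : Fin 5 → V) :
    e.det (Matrix.vecCons (s • x + t • y) m) =
      s * e.det (Matrix.vecCons x m) + t * e.det (Matrix.vecCons y m) := by
  simp only [← AlternatingMap.curryLeft_apply_apply]
  simp

theorem det_swap_zero_one (e : Module.Basis (Fin 6) ℝ V) (x y a b c d : V) :
    e.det ![x, y, a, b, c, d] = -e.det ![y, x, a, b, c, d] := by
  rw [← e.det.map_swap ![y, x, a, b, c, d] (i := 0) (j := 1) (by decide)]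
  congr 1
  ext i; fin_cases i <;> rfl

theorem wedge₂_comm (α β : V →ₗ[ℝ] V →ₗ[ℝ] ℝ) (a b c d : V) :
    wedge₂ α β a b c d = wedge₂ β α a b c d := by
  simp only [wedge₂]; ring

theorem linearIndependent_of_det_ne_zero (e : Module.Basis (Fin 6) ℝ V) {m : Fin 6 → V}
    (h : e.det m ≠ 0) : LinearIndependent ℝ m := by
  by_contra hm
  exact h (e.det.map_linearDependent m hm)

theorem exists_basis_of_det_ne_zero (e : Module.Basis (Fin 6) ℝ V) {m : Fin 6 → V}
    (h : e.det m ≠ 0) : ∃ B : Module.Basis (Fin 6) ℝ V, ⇑B = m := by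
  have hli := linearIndependent_of_det_ne_zero e h
  have hfr : Module.finrank ℝ V = 6 := by simpa using Module.finrank_eq_card_basis e
  exact ⟨basisOfLinearIndependentOfCardEqFinrank hli (by simp [hfr]), by simp⟩

variable [TopologicalSpace V]

theorem wedge₂_contract_smul (ρ : V [⋀^Fin 3]→L[ℝ] ℝ) (α : V →ₗ[ℝ] V →ₗ[ℝ] ℝ) (s : ℝ) (x : V)
    (a b c d : V) :
    wedge₂ α (contract ρ (s • x)) a b c d = s * wedge₂ α (contract ρ x) a b c d := by
  simp only [wedge₂, contract_smul, LinearMap.smul_apply, smul_eq_mul]; ring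

theorem wedge₂_contract_add (ρ : V [⋀^Fin 3]→L[ℝ] ℝ) (α : V →ₗ[ℝ] V →ₗ[ℝ] ℝ) (x y : V)
    (a b c d : V) :
    wedge₂ α (contract ρ (x + y)) a b c d =
      wedge₂ α (contract ρ x) a b c d + wedge₂ α (contract ρ y) a b c d := by
  simp only [wedge₂, contract_add, LinearMap.add_apply]; ring

variable {ρ : V [⋀^Fin 3]→L[ℝ] ℝ}

/-- Complete `Kv, v` to a basis by vectors on which `(i_v ρ)²` is positive. A coordinate of `y ∈
N_v` along one of these four vectors is, up to a non-zero factor, `(i_v ρ)²` with `y` in one slot,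
hence zero. -/
theorem nullSpace_eq_span (hρ : IsDefinite ρ) (e : Module.Basis (Fin 6) ℝ V) {v : V}
    (hv : v ≠ 0) : nullSpace ρ v = Submodule.span ℝ {hitchinMap e ρ v, v} := by
  have : Module.Finite ℝ V := .of_basis e
  obtain ⟨a, b, c, d, hpos⟩ := exists_wedge₂_self_pos hρ e hv
  have hdet : ∀ a b c d, e.det ![hitchinMap e ρ v, v, a, b, c, d] =
      2 * wedge₂ (contract ρ v) (contract ρ v) a b c d := fun a b c d =>
    (two_mul_wedge₂_eq_det e ρ (self_mem_nullSpace ρ v) a b c d).symm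
  have hne : e.det ![hitchinMap e ρ v, v, a, b, c, d] ≠ 0 := by
    rw [hdet]; positivity
  obtain ⟨B, hB⟩ := exists_basis_of_det_ne_zero e hne
  refine Submodule.eq_of_le_of_finrank_le (fun y hy => ?_) ?_
  · have hl := contract_of_mem_nullSpace_left hy
    have hr := contract_of_mem_nullSpace_right hy
    have hzero : ∀ i : Fin 6, e.det (Function.update B i y) = 0 → B.repr y i = 0 := fun i hi => by
      rw [alternating_update_basis, hB] at hi
      exact (mul_eq_zero.1 hi).resolve_right hne
    have h2 : B.repr y 2 = 0 := hzero 2 <| by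
      rw [hB, show Function.update ![hitchinMap e ρ v, v, a, b, c, d] 2 y =
        ![hitchinMap e ρ v, v, y, b, c, d] by ext i; fin_cases i <;> rfl, hdet]
      simp [wedge₂, hl]
    have h3 : B.repr y 3 = 0 := hzero 3 <| by
      rw [hB, show Function.update ![hitchinMap e ρ v, v, a, b, c, d] 3 y =
        ![hitchinMap e ρ v, v, a, y, c, d] by ext i; fin_cases i <;> rfl, hdet]
      simp [wedge₂, hl, hr]
    have h4 : B.repr y 4 = 0 := hzero 4 <| by
      rw [hB, show Function.update ![hitchinMap e ρ v, v, a, b, c, d] 4 y =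
        ![hitchinMap e ρ v, v, a, b, y, d] by ext i; fin_cases i <;> rfl, hdet]
      simp [wedge₂, hl, hr]
    have h5 : B.repr y 5 = 0 := hzero 5 <| by
      rw [hB, show Function.update ![hitchinMap e ρ v, v, a, b, c, d] 5 y =
        ![hitchinMap e ρ v, v, a, b, c, y] by ext i; fin_cases i <;> rfl, hdet]
      simp [wedge₂, hr]
    have hsum := B.sum_repr y
    rw [Fin.sum_univ_six, h2, h3, h4, h5, hB] at hsum
    refine Submodule.mem_span_pair.2 ⟨B.repr y 0, B.repr y 1, ?_⟩
    simpa using hsum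
  · rw [finrank_nullSpace hρ e hv]
    classical
    have := finrank_span_finset_le_card (R := ℝ) ({hitchinMap e ρ v, v} : Finset V)
    simp only [Finset.coe_insert, Finset.coe_singleton] at this
    exact this.trans Finset.card_le_two

theorem hitchinMap_mem_nullSpace (hρ : IsDefinite ρ) (e : Module.Basis (Fin 6) ℝ V) {v : V}
    (hv : v ≠ 0) : hitchinMap e ρ v ∈ nullSpace ρ v := by
  rw [nullSpace_eq_span hρ e hv]
  exact Submodule.subset_span (by simp)

theorem wedge₂_hitchinMap (hρ : IsDefinite ρ) (e : Module.Basis (Fin 6) ℝ V) {v : V}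
    (hv : v ≠ 0) (a b c d : V) :
    wedge₂ (contract ρ v) (contract ρ (hitchinMap e ρ v)) a b c d = 0 := by
  have h := two_mul_wedge₂_eq_det e ρ (hitchinMap_mem_nullSpace hρ e hv) a b c d
  rw [e.det.map_eq_zero_of_eq _ (i := 0) (j := 1) rfl (by decide)] at h
  linarith

theorem hitchinMap_ne_zero (hρ : IsDefinite ρ) (e : Module.Basis (Fin 6) ℝ V) {v : V}
    (hv : v ≠ 0) : hitchinMap e ρ v ≠ 0 := by
  intro h
  obtain ⟨a, b, c, d, hpos⟩ := exists_wedge₂_self_pos hρ e hv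
  have h2 := two_mul_wedge₂_eq_det e ρ (self_mem_nullSpace ρ v) a b c d
  rw [h, e.det.map_coord_zero (i := 0) rfl] at h2
  linarith

/-- The planes of `v` and `Kv` coincide, so `K²v = t Kv + s v`. The determinant identity at `Kv`
gives `t = 0` when contracted with `v`, by orthogonality, and the ratio `-s` of squared lengths when
contracted with `Kv`. -/
theorem exists_hitchinMap_hitchinMap_eq (hρ : IsDefinite ρ) (e : Module.Basis (Fin 6) ℝ V) {v : V}
    (hv : v ≠ 0) : ∃ s < 0, hitchinMap e ρ (hitchinMap e ρ v) = s • v ∧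
      ∀ a b c d, wedge₂ (contract ρ (hitchinMap e ρ v)) (contract ρ (hitchinMap e ρ v)) a b c d =
        -s * wedge₂ (contract ρ v) (contract ρ v) a b c d := by
  have : Module.Finite ℝ V := .of_basis e
  have hKv := hitchinMap_ne_zero hρ e hv
  have hmem := hitchinMap_mem_nullSpace hρ e hv
  have hN : nullSpace ρ v = nullSpace ρ (hitchinMap e ρ v) := by
    refine Submodule.eq_of_le_of_finrank_le ?_ ?_
    · rw [nullSpace_eq_span hρ e hv, Submodule.span_le, Set.insert_subset_iff,
        Set.singleton_subset_iff]
      exact ⟨self_mem_nullSpace _ _, mem_nullSpace_comm hmem⟩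
    · rw [finrank_nullSpace hρ e hv, finrank_nullSpace hρ e hKv]
  have hKK := hitchinMap_mem_nullSpace hρ e hKv
  rw [← hN, nullSpace_eq_span hρ e hv, Submodule.mem_span_pair] at hKK
  obtain ⟨t, s, hts⟩ := hKK
  have hvK := two_mul_wedge₂_eq_det e ρ (mem_nullSpace_comm hmem)
  have hKKw := two_mul_wedge₂_eq_det e ρ (self_mem_nullSpace ρ (hitchinMap e ρ v))
  have hvv := two_mul_wedge₂_eq_det e ρ (self_mem_nullSpace ρ v)
  obtain ⟨a, b, c, d, hpos⟩ := exists_wedge₂_self_pos hρ e hv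
  have ht : t = 0 := by
    have h := hvK a b c d
    rw [wedge₂_comm, wedge₂_hitchinMap hρ e hv, ← hts, det_cons_linear_comb, ← hvv,
      e.det.map_eq_zero_of_eq ![v, v, a, b, c, d] (i := 0) (j := 1) rfl (by decide)] at h
    have : t * wedge₂ (contract ρ v) (contract ρ v) a b c d = 0 := by linarith
    exact (mul_eq_zero.1 this).resolve_right hpos.ne'
  have hlen : ∀ a b c d,
      wedge₂ (contract ρ (hitchinMap e ρ v)) (contract ρ (hitchinMap e ρ v)) a b c d =
        -s * wedge₂ (contract ρ v) (contract ρ v) a b c d := fun a b c d => by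
    have h := hKKw a b c d
    rw [← hts, det_cons_linear_comb, ht, det_swap_zero_one e v, ← hvv] at h
    linarith
  refine ⟨s, ?_, by rw [← hts, ht, zero_smul, zero_add], hlen⟩
  -- If `s ≥ 0`, then `√s v + Kv` is a non-zero vector with square `s (i_v ρ)² - s (i_v ρ)² = 0`,
  -- which definiteness excludes.
  by_contra! hs
  have hu : Real.sqrt s • v + hitchinMap e ρ v ≠ 0 := by
    intro h
    have hK : hitchinMap e ρ v = (-Real.sqrt s) • v := by
      rw [neg_smul]; exact (neg_eq_of_add_eq_zero_right h).symm
    have h2 := hvv a b c d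
    rw [hK, ← add_zero ((-Real.sqrt s) • v), ← zero_smul ℝ v, det_cons_linear_comb,
      e.det.map_eq_zero_of_eq ![v, v, a, b, c, d] (i := 0) (j := 1) rfl (by decide)] at h2
    linarith
  obtain ⟨a, b, c, d, hpos'⟩ := exists_wedge₂_self_pos hρ e hu
  rw [wedge₂_contract_add, wedge₂_contract_smul, wedge₂_comm,
    wedge₂_comm _ (contract ρ (hitchinMap e ρ v)), wedge₂_contract_add, wedge₂_contract_add,
    wedge₂_contract_smul, wedge₂_contract_smul, hlen,
    wedge₂_comm (contract ρ (hitchinMap e ρ v)) (contract ρ v), wedge₂_hitchinMap hρ e hv] at hpos'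
  have h0 : √s * √s * wedge₂ (contract ρ v) (contract ρ v) a b c d =
      s * wedge₂ (contract ρ v) (contract ρ v) a b c d := by rw [Real.mul_self_sqrt hs]
  linarith

end Linear

/-! ### The complex structure `I_ρ`. -/

section Linear

variable {V : Type*} [AddCommGroup V] [Module ℝ V] [TopologicalSpace V]

/-- The number `c` with `K² = -c`, for the endomorphism `K = hitchinMap e ρ`. -/
def hitchinScale (e : Module.Basis (Fin 6) ℝ V) (ρ : V [⋀^Fin 3]→L[ℝ] ℝ) : ℝ :=
  -e.repr (hitchinMap e ρ (hitchinMap e ρ (e 0))) 0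

/-- The complex structure induced by a definite form and the orientation of the basis `e`. -/
def turn (e : Module.Basis (Fin 6) ℝ V) (ρ : V [⋀^Fin 3]→L[ℝ] ℝ) : V →ₗ[ℝ] V :=
  (-(√(hitchinScale e ρ))⁻¹) • hitchinMap e ρ

variable {ρ : V [⋀^Fin 3]→L[ℝ] ℝ}

/-- Every non-zero vector is an eigenvector of `K²`, so `K²` is a scalar and the eigenvalue does not
depend on `v`. -/
theorem hitchinMap_hitchinMap (hρ : IsDefinite ρ) (e : Module.Basis (Fin 6) ℝ V) (v : V) :
    hitchinMap e ρ (hitchinMap e ρ v) = (-hitchinScale e ρ) • v := by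
  have : Module.Free ℝ V := .of_basis e
  obtain ⟨s, hs⟩ := LinearMap.exists_eq_smul_id_of_forall_notLinearIndependent (R := ℝ)
    (f := hitchinMap e ρ ∘ₗ hitchinMap e ρ) fun v h => by
      have hv : v ≠ 0 := h.ne_zero 0
      obtain ⟨s, -, h', -⟩ := exists_hitchinMap_hitchinMap_eq hρ e hv
      have := LinearIndependent.pair_iff.1 h s (-1) (by simp [h'])
      norm_num at this
  have hs' : ∀ v, hitchinMap e ρ (hitchinMap e ρ v) = s • v := fun v => by
    simpa using congrArg (fun g : V →ₗ[ℝ] V => g v) hs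
  have : s = -hitchinScale e ρ := by simp [hitchinScale, hs']
  rw [hs', this]

theorem hitchinScale_pos (hρ : IsDefinite ρ) (e : Module.Basis (Fin 6) ℝ V) :
    0 < hitchinScale e ρ := by
  obtain ⟨s, hs, h, -⟩ := exists_hitchinMap_hitchinMap_eq hρ e (e.ne_zero 0)
  have : hitchinScale e ρ = -s := by simp [hitchinScale, h]
  linarith

theorem wedge₂_hitchinMap_self (hρ : IsDefinite ρ) (e : Module.Basis (Fin 6) ℝ V) {v : V}
    (hv : v ≠ 0) (a b c d : V) :
    wedge₂ (contract ρ (hitchinMap e ρ v)) (contract ρ (hitchinMap e ρ v)) a b c d =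
      hitchinScale e ρ * wedge₂ (contract ρ v) (contract ρ v) a b c d := by
  obtain ⟨s, -, h, h'⟩ := exists_hitchinMap_hitchinMap_eq hρ e hv
  have : s = -hitchinScale e ρ := by
    rw [hitchinMap_hitchinMap hρ] at h
    exact (smul_left_injective ℝ hv h).symm
  rw [h', this, neg_neg]

theorem turn_apply (e : Module.Basis (Fin 6) ℝ V) (ρ : V [⋀^Fin 3]→L[ℝ] ℝ) (v : V) :
    turn e ρ v = (-(√(hitchinScale e ρ))⁻¹) • hitchinMap e ρ v :=
  rfl

theorem turn_turn (hρ : IsDefinite ρ) (e : Module.Basis (Fin 6) ℝ V) (v : V) :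
    turn e ρ (turn e ρ v) = -v := by
  have hpos := hitchinScale_pos hρ e
  have hsq := Real.mul_self_sqrt hpos.le
  have hne : √(hitchinScale e ρ) ≠ 0 := (Real.sqrt_pos.2 hpos).ne'
  rw [turn_apply, turn_apply, map_smul, hitchinMap_hitchinMap hρ, smul_smul, smul_smul,
    ← neg_one_smul ℝ v]
  congr 1
  field_simp
  linarith

theorem turn_mem_nullSpace (hρ : IsDefinite ρ) (e : Module.Basis (Fin 6) ℝ V) (v : V) :
    turn e ρ v ∈ nullSpace ρ v := by
  rcases eq_or_ne v 0 with rfl | hv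
  · simp
  · exact Submodule.smul_mem _ _ (hitchinMap_mem_nullSpace hρ e hv)

theorem nullSpace_eq_span_turn (hρ : IsDefinite ρ) (e : Module.Basis (Fin 6) ℝ V) {v : V}
    (hv : v ≠ 0) : nullSpace ρ v = Submodule.span ℝ {turn e ρ v, v} := by
  have hne : √(hitchinScale e ρ) ≠ 0 := (Real.sqrt_pos.2 (hitchinScale_pos hρ e)).ne'
  apply le_antisymm
  · rw [nullSpace_eq_span hρ e hv, Submodule.span_le, Set.insert_subset_iff,
      Set.singleton_subset_iff]
    refine ⟨Submodule.mem_span_pair.2 ⟨-√(hitchinScale e ρ), 0, ?_⟩,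
      Submodule.subset_span (by simp)⟩
    rw [turn_apply, smul_smul, zero_smul, add_zero, neg_mul_neg, mul_inv_cancel₀ hne, one_smul]
  · rw [Submodule.span_le, Set.insert_subset_iff, Set.singleton_subset_iff]
    exact ⟨turn_mem_nullSpace hρ e v, self_mem_nullSpace ρ v⟩

theorem isInducedComplexStructure_turn (hρ : IsDefinite ρ) (e : Module.Basis (Fin 6) ℝ V) :
    IsInducedComplexStructure e.orientation ρ (turn e ρ) := by
  intro v hv
  have hpos := hitchinScale_pos hρ e
  have hsq := Real.mul_self_sqrt hpos.le
  have hspos := Real.sqrt_pos.2 hpos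
  have hne : √(hitchinScale e ρ) ≠ 0 := hspos.ne'
  refine ⟨turn_mem_nullSpace hρ e v, fun a b c d => ?_, fun a b c d => ?_, fun a b c d h => ?_⟩
  · rw [turn_apply, wedge₂_contract_smul, wedge₂_hitchinMap hρ e hv, mul_zero]
  · rw [turn_apply, wedge₂_contract_smul, wedge₂_comm, wedge₂_contract_smul,
      wedge₂_hitchinMap_self hρ e hv]
    field_simp
    rw [Real.sq_sqrt hpos.le]
  -- The sign in `turn` is settled here: `(Kv, v)` is the positive basis of `N_v`, so the quarter
  -- turn is along `-Kv`.
  · have hdet : e.det ![v, turn e ρ v, a, b, c, d] =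
        (√(hitchinScale e ρ))⁻¹ * (2 * wedge₂ (contract ρ v) (contract ρ v) a b c d) := by
      rw [det_swap_zero_one, turn_apply, ← add_zero (_ • hitchinMap e ρ v), ← zero_smul ℝ v,
        det_cons_linear_comb, ← two_mul_wedge₂_eq_det e ρ (self_mem_nullSpace ρ v)]
      ring
    have hdpos : 0 < e.det ![v, turn e ρ v, a, b, c, d] := by
      rw [hdet]; positivity
    obtain ⟨B, hB⟩ := exists_basis_of_det_ne_zero e hdpos.ne'
    refine ⟨B, hB, ((e.orientation_eq_iff_det_pos B).2 ?_).symm⟩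
    rwa [hB]

/-- In `w = q Jv + p v`, with `J = turn e ρ`, orthogonality gives `p = 0`, equality of lengths gives
`q² = 1`, and the orientation gives `q = 1`. Consequently `turn` depends on the basis only through
its orientation. -/
theorem IsQuarterTurn.eq_turn (hρ : IsDefinite ρ) (e : Module.Basis (Fin 6) ℝ V) {v w : V}
    (hv : v ≠ 0) (h : IsQuarterTurn e.orientation ρ v w) : w = turn e ρ v := by
  have ht := isInducedComplexStructure_turn hρ e v hv
  have hw := h.mem
  rw [nullSpace_eq_span_turn hρ e hv, Submodule.mem_span_pair] at hw
  obtain ⟨q, p, rfl⟩ := hw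
  obtain ⟨a, b, c, d, hpos⟩ := exists_wedge₂_self_pos hρ e hv
  have hp : p = 0 := by
    have := h.orthogonal a b c d
    rw [wedge₂_contract_add, wedge₂_contract_smul, wedge₂_contract_smul, ht.orthogonal, mul_zero,
      zero_add] at this
    exact (mul_eq_zero.1 this).resolve_right hpos.ne'
  subst hp
  rw [zero_smul, add_zero] at h ⊢
  have hq : q * q = 1 := by
    have := h.same_length a b c d
    rw [wedge₂_contract_smul, wedge₂_comm, wedge₂_contract_smul, ht.same_length] at this
    have h' : (q * q - 1) * wedge₂ (contract ρ v) (contract ρ v) a b c d = 0 := by linarith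
    linarith [(mul_eq_zero.1 h').resolve_right hpos.ne']
  obtain ⟨B, hB, hBo⟩ := h.oriented a b c d hpos
  obtain ⟨B', hB', hBo'⟩ := ht.oriented a b c d hpos
  have hd := (e.orientation_eq_iff_det_pos B).1 hBo.symm
  have hd' := (e.orientation_eq_iff_det_pos B').1 hBo'.symm
  rw [hB, det_swap_zero_one, ← add_zero (_ • turn e ρ v), ← zero_smul ℝ v,
    det_cons_linear_comb, zero_mul, add_zero] at hd
  rw [hB', det_swap_zero_one] at hd'
  have hq1 : q = 1 := by
    rcases mul_self_eq_one_iff.1 hq with h | h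
    · exact h
    · rw [h] at hd
      change 0 < -(-1 * e.det ![turn e ρ v, v, a, b, c, d]) at hd
      linarith
  rw [hq1, one_smul]

theorem existsUnique_isInducedComplexStructure (hρ : IsDefinite ρ)
    (e : Module.Basis (Fin 6) ℝ V) :
    ∃! J, IsInducedComplexStructure e.orientation ρ J := by
  refine ⟨turn e ρ, isInducedComplexStructure_turn hρ e, fun J hJ => LinearMap.ext fun v => ?_⟩
  rcases eq_or_ne v 0 with rfl | hv
  · simp
  · exact (hJ v hv).eq_turn hρ e hv

theorem inducedComplexStructure_eq_turn (hρ : IsDefinite ρ) (e : Module.Basis (Fin 6) ℝ V) :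
    inducedComplexStructure e.orientation ρ = turn e ρ := by
  have h := existsUnique_isInducedComplexStructure hρ e
  rw [inducedComplexStructure, dif_pos h.exists]
  exact h.unique h.exists.choose_spec (isInducedComplexStructure_turn hρ e)

/-- Polarisation of `i_{Jv} i_v ρ = 0` at `v = x + y`. -/
theorem contract_turn (hρ : IsDefinite ρ) (e : Module.Basis (Fin 6) ℝ V) (x y z : V) :
    contract ρ (turn e ρ x) y z = contract ρ x (turn e ρ y) z := by
  have h := contract_of_mem_nullSpace_left (turn_mem_nullSpace hρ e (x + y)) z
  have hx := contract_of_mem_nullSpace_left (turn_mem_nullSpace hρ e x) z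
  have hy := contract_of_mem_nullSpace_left (turn_mem_nullSpace hρ e y) z
  simp only [map_add, contract_add, LinearMap.add_apply] at h
  rw [contract_swap_left]
  linarith

end Linear

/-! ### Forms of type `(3,0)` and the conjugate form `ρ̃`. -/

section Linear

variable {V : Type*} [AddCommGroup V] [Module ℝ V] [TopologicalSpace V]

theorem complexEval_three (α : V [⋀^Fin 3]→L[ℝ] ℂ) (x y : Fin 3 → V) :
    complexEval α x y = α ![x 0, x 1, x 2] + Complex.I * α ![y 0, x 1, x 2]
      + Complex.I * α ![x 0, y 1, x 2] + Complex.I * α ![x 0, x 1, y 2]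
      - α ![y 0, y 1, x 2] - α ![y 0, x 1, y 2] - α ![x 0, y 1, y 2]
      - Complex.I * α ![y 0, y 1, y 2] := by
  have huniv : (Finset.univ : Finset (Finset (Fin 3))) =
      {∅, {0}, {1}, {2}, {0, 1}, {0, 2}, {1, 2}, {0, 1, 2}} := by decide
  have hα : ∀ S : Finset (Fin 3), α (fun j => if j ∈ S then y j else x j) =
      α ![if 0 ∈ S then y 0 else x 0, if 1 ∈ S then y 1 else x 1,
        if 2 ∈ S then y 2 else x 2] := fun S => by
    congr 1; ext i; fin_cases i <;> rfl
  have hcard : ({0, 1, 2} : Finset (Fin 3)).card = 3 := rfl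
  rw [complexEval, huniv]
  repeat rw [Finset.sum_insert (by decide)]
  rw [Finset.sum_singleton, hcard]
  simp only [hα]
  simp [Complex.I_sq, Complex.I_pow_three]
  ring

theorem complexEval_four (α : V [⋀^Fin 4]→L[ℝ] ℂ) (x y : Fin 4 → V) :
    complexEval α x y = α ![x 0, x 1, x 2, x 3]
      + Complex.I * (α ![y 0, x 1, x 2, x 3] + α ![x 0, y 1, x 2, x 3]
        + α ![x 0, x 1, y 2, x 3] + α ![x 0, x 1, x 2, y 3])
      - (α ![y 0, y 1, x 2, x 3] + α ![y 0, x 1, y 2, x 3] + α ![y 0, x 1, x 2, y 3]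
        + α ![x 0, y 1, y 2, x 3] + α ![x 0, y 1, x 2, y 3] + α ![x 0, x 1, y 2, y 3])
      - Complex.I * (α ![x 0, y 1, y 2, y 3] + α ![y 0, x 1, y 2, y 3]
        + α ![y 0, y 1, x 2, y 3] + α ![y 0, y 1, y 2, x 3])
      + α ![y 0, y 1, y 2, y 3] := by
  have huniv : (Finset.univ : Finset (Finset (Fin 4))) =
      {∅, {0}, {1}, {2}, {3}, {0, 1}, {0, 2}, {0, 3}, {1, 2}, {1, 3}, {2, 3}, {1, 2, 3},
        {0, 2, 3}, {0, 1, 3}, {0, 1, 2}, {0, 1, 2, 3}} := by decide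
  have hα : ∀ S : Finset (Fin 4), α (fun j => if j ∈ S then y j else x j) =
      α ![if 0 ∈ S then y 0 else x 0, if 1 ∈ S then y 1 else x 1,
        if 2 ∈ S then y 2 else x 2, if 3 ∈ S then y 3 else x 3] := fun S => by
    congr 1; ext i; fin_cases i <;> rfl
  have h1 : ({1, 2, 3} : Finset (Fin 4)).card = 3 := rfl
  have h2 : ({0, 2, 3} : Finset (Fin 4)).card = 3 := rfl
  have h3 : ({0, 1, 3} : Finset (Fin 4)).card = 3 := rfl
  have h4 : ({0, 1, 2} : Finset (Fin 4)).card = 3 := rfl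
  have h5 : ({0, 1, 2, 3} : Finset (Fin 4)).card = 4 := rfl
  rw [complexEval, huniv]
  repeat rw [Finset.sum_insert (by decide)]
  rw [Finset.sum_singleton, h1, h2, h3, h4, h5]
  simp only [hα]
  simp [Complex.I_sq, Complex.I_pow_three, Complex.I_pow_four]
  ring

theorem complexify_apply {k : ℕ} (α : V [⋀^Fin k]→L[ℝ] ℝ) (m : Fin k → V) :
    complexify α m = (α m : ℂ) :=
  rfl

theorem complexify_add_I_smul_apply (ρ σ : V [⋀^Fin 3]→L[ℝ] ℝ) (a b c : V) :
    (complexify ρ + Complex.I • complexify σ) ![a, b, c] =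
      contract ρ a b c + Complex.I * contract σ a b c :=
  rfl

variable [IsTopologicalAddGroup V] [ContinuousSMul ℝ V]

theorem IsConjugate.contract_eq {J : V →ₗ[ℝ] V} {ρ σ : V [⋀^Fin 3]→L[ℝ] ℝ}
    (h : IsConjugate J ρ σ) (x y z : V) : contract σ x y z = -contract ρ (J x) y z := by
  have h0 := h.2 ![x, y, z] ∅ (by decide)
  have h1 := h.2 ![x, y, z] {1} (by decide)
  have h2 := h.2 ![x, y, z] {2} (by decide)
  have h3 := h.2 ![x, y, z] {1, 2} (by decide)
  rw [complexEval_three] at h0 h1 h2 h3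
  simp only [complexify_add_I_smul_apply] at h0 h1 h2 h3
  simp at h0 h1 h2 h3
  -- Averaging over the two types in the last two slots replaces `y ± iJy`, `z ± iJz` by `y`, `z`,
  -- leaving `Θ(x + iJx, y, z) = 0`. The imaginary part is the claim.
  have key : ((contract ρ x y z : ℝ) : ℂ) + Complex.I * contract σ x y z +
      Complex.I * (contract ρ (J x) y z + Complex.I * contract σ (J x) y z) = 0 := by
    linear_combination (h0 + h1 + h2 + h3) / 4
  have := congrArg Complex.im key
  simp at this
  linarith

/-- The hypotheses make `Θ` complex linear for `J` in each slot, so an argument `x + iJx`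
contributes the factor `1 + i² = 0`. -/
theorem isConjugate_of_contract_eq {J : V →ₗ[ℝ] V} {ρ σ : V [⋀^Fin 3]→L[ℝ] ℝ}
    (hJ : ∀ v, J (J v) = -v) (hρ : ∀ x y z, contract ρ (J x) y z = contract ρ x (J y) z)
    (h : ∀ x y z, contract σ x y z = -contract ρ (J x) y z) : IsConjugate J ρ σ := by
  refine ⟨rfl, fun x S hS => ?_⟩
  set Θ := complexify ρ + Complex.I • complexify σ with hΘ
  have t0 : ∀ a b c, Θ ![J a, b, c] = Complex.I * Θ ![a, b, c] := fun a b c => by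
    rw [hΘ, complexify_add_I_smul_apply, complexify_add_I_smul_apply, h, h, hJ, contract_neg]
    simp only [LinearMap.neg_apply]
    push_cast
    linear_combination (contract ρ (J a) b c : ℂ) * Complex.I_sq
  have t1 : ∀ a b c, Θ ![a, J b, c] = Complex.I * Θ ![a, b, c] := fun a b c => by
    rw [← t0]
    simp only [hΘ, complexify_add_I_smul_apply, h, hρ]
  have t2 : ∀ a b c, Θ ![a, b, J c] = Complex.I * Θ ![a, b, c] := fun a b c => by
    have sw : ∀ a b c, Θ ![a, b, c] = -Θ ![a, c, b] := fun a b c => by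
      simp only [hΘ, complexify_add_I_smul_apply]
      rw [contract_swap ρ, contract_swap σ]
      push_cast; ring
    rw [sw, t1, sw a b c]; ring
  have n0 : ∀ a b c, Θ ![-a, b, c] = -Θ ![a, b, c] := fun a b c => by
    simp only [hΘ, complexify_add_I_smul_apply, contract_neg, LinearMap.neg_apply]
    push_cast; ring
  have n1 : ∀ a b c, Θ ![a, -b, c] = -Θ ![a, b, c] := fun a b c => by
    simp only [hΘ, complexify_add_I_smul_apply, map_neg, LinearMap.neg_apply]
    push_cast; ring
  have n2 : ∀ a b c, Θ ![a, b, -c] = -Θ ![a, b, c] := fun a b c => by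
    simp only [hΘ, complexify_add_I_smul_apply, map_neg]
    push_cast; ring
  have hI := Complex.I_sq
  rw [complexEval_three]
  by_cases s0 : (0 : Fin 3) ∈ S <;> by_cases s1 : (1 : Fin 3) ∈ S <;>
    by_cases s2 : (2 : Fin 3) ∈ S <;> simp only [s0, s1, s2, if_true, if_false, t0, t1, t2, n0,
      n1, n2]
  · refine absurd ?_ hS
    have : S = Finset.univ := by
      ext i; fin_cases i <;> simpa
    rw [this]; rfl
  all_goals
    generalize Θ ![x 0, x 1, x 2] = t
    ring_nf
    simp [Complex.I_sq, Complex.I_pow_four]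
    try ring_nf

variable [T2Space V] [FiniteDimensional ℝ V]

theorem exists_contract_eq {J : V →ₗ[ℝ] V} {ρ : V [⋀^Fin 3]→L[ℝ] ℝ}
    (hρ : ∀ x y z, contract ρ (J x) y z = contract ρ x (J y) z) :
    ∃ σ : V [⋀^Fin 3]→L[ℝ] ℝ, ∀ x y z, contract σ x y z = -contract ρ (J x) y z := by
  let g : V [×3]→L[ℝ] ℝ := -ρ.toContinuousMultilinearMap.compContinuousLinearMap
    ![J.toContinuousLinearMap, .id ℝ V, .id ℝ V]
  have hg : ∀ m, g m = -contract ρ (J (m 0)) (m 1) (m 2) := fun m => by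
    refine congrArg (fun t => -ρ t) ?_
    ext i; fin_cases i <;> rfl
  refine ⟨{ g with map_eq_zero_of_eq' := fun m i j hm hij => ?_ }, fun x y z => hg ![x, y, z]⟩
  change g m = 0
  rw [hg]
  -- Symmetry moves `J` to the second slot, and alternation returns it to the first with a minus
  -- sign.
  have h01 : ∀ a c, contract ρ (J a) a c = 0 := fun a c => by
    linarith [hρ a a c, contract_swap_left ρ (J a) a c]
  have h02 : ∀ a b, contract ρ (J a) b a = 0 := fun a b => by
    rw [contract_swap, h01, neg_zero]
  clear hρ
  fin_cases i <;> fin_cases j <;> simp_all [contract_self]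

theorem existsUnique_isConjugate {ρ : V [⋀^Fin 3]→L[ℝ] ℝ} (hρ : IsDefinite ρ)
    (e : Module.Basis (Fin 6) ℝ V) :
    ∃! σ, IsConjugate (inducedComplexStructure e.orientation ρ) ρ σ := by
  rw [inducedComplexStructure_eq_turn hρ e]
  obtain ⟨σ, hσ⟩ := exists_contract_eq (contract_turn hρ e)
  refine ⟨σ, isConjugate_of_contract_eq (turn_turn hρ e) (contract_turn hρ e) hσ,
    fun τ hτ => ?_⟩
  ext m
  have hm : m = ![m 0, m 1, m 2] := by ext i; fin_cases i <;> rfl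
  rw [hm, ← contract_apply, ← contract_apply, hσ, hτ.contract_eq]

theorem contract_conjugateForm {ρ : V [⋀^Fin 3]→L[ℝ] ℝ} (hρ : IsDefinite ρ)
    (e : Module.Basis (Fin 6) ℝ V) (x y z : V) :
    contract (conjugateForm e.orientation ρ) x y z = -contract ρ (turn e ρ x) y z := by
  have h := (existsUnique_isConjugate hρ e).exists
  have hc : IsConjugate (inducedComplexStructure e.orientation ρ) ρ
      (conjugateForm e.orientation ρ) := by
    rw [conjugateForm, dif_pos h]
    exact h.choose_spec
  rw [inducedComplexStructure_eq_turn hρ e] at hc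
  exact hc.contract_eq x y z

end Linear

/-! ### Compatibility with linear maps that match bases. -/

section Naturality

variable {V W : Type*} [AddCommGroup V] [Module ℝ V] [TopologicalSpace V]
  [AddCommGroup W] [Module ℝ W] [TopologicalSpace W]

theorem contract_comp (ρ : V [⋀^Fin 3]→L[ℝ] ℝ) (A : W →L[ℝ] V) (x y z : W) :
    contract (ρ.compContinuousLinearMap A) x y z = contract ρ (A x) (A y) (A z) := by
  refine congrArg ρ ?_
  ext i; fin_cases i <;> rfl

theorem contractWedge_comp (ρ : V [⋀^Fin 3]→L[ℝ] ℝ) (A : W →L[ℝ] V) (v : W) (x : Fin 5 → W) :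
    contractWedge (ρ.compContinuousLinearMap A) v x = contractWedge ρ (A v) (A ∘ x) := by
  rw [contractWedge_apply, contractWedge_apply]
  simp only [← contract_apply, contract_comp]
  rfl

theorem hitchinMap_comp (ρ : V [⋀^Fin 3]→L[ℝ] ℝ) (A : W →L[ℝ] V) {e : Module.Basis (Fin 6) ℝ W}
    {e' : Module.Basis (Fin 6) ℝ V} (h : ∀ i, e' i = A (e i)) (v : W) :
    hitchinMap e' ρ (A v) = A (hitchinMap e (ρ.compContinuousLinearMap A) v) := by
  rw [hitchinMap_apply, hitchinMap_apply, map_sum]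
  refine Finset.sum_congr rfl fun i _ => ?_
  rw [map_smul, contractWedge_comp, h]
  have : i.removeNth e' = A ∘ i.removeNth e := funext fun j => h _
  rw [this]

theorem turn_comp (ρ : V [⋀^Fin 3]→L[ℝ] ℝ) (A : W →L[ℝ] V) {e : Module.Basis (Fin 6) ℝ W}
    {e' : Module.Basis (Fin 6) ℝ V} (h : ∀ i, e' i = A (e i)) (v : W) :
    turn e' ρ (A v) = A (turn e (ρ.compContinuousLinearMap A) v) := by
  have hrepr : ∀ w, e'.repr (A w) 0 = e.repr w 0 := by
    have : e'.coord 0 ∘ₗ A.toLinearMap = e.coord 0 := by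
      refine e.ext fun i => ?_
      simp [← h, Finsupp.single_apply]
    exact fun w => congrArg (fun g : W →ₗ[ℝ] ℝ => g w) this
  have hs : hitchinScale e' ρ = hitchinScale e (ρ.compContinuousLinearMap A) := by
    rw [hitchinScale, hitchinScale, h, hitchinMap_comp ρ A h, hitchinMap_comp ρ A h, hrepr]
  rw [turn_apply, turn_apply, hs, hitchinMap_comp ρ A h, map_smul]

theorem IsDefinite.comp {ρ : V [⋀^Fin 3]→L[ℝ] ℝ} (hρ : IsDefinite ρ) (A : W ≃L[ℝ] V) :
    IsDefinite (ρ.compContinuousLinearMap (A : W →L[ℝ] V)) := by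
  intro v hv
  have hA : A v ≠ 0 := by simpa using hv
  rw [← hρ (A v) hA]
  have : contract (ρ.compContinuousLinearMap (A : W →L[ℝ] V)) v =
      (A.toLinearEquiv.dualMap : (V →ₗ[ℝ] ℝ) →ₗ[ℝ] W →ₗ[ℝ] ℝ) ∘ₗ contract ρ (A v) ∘ₗ
        (A.toLinearEquiv : W →ₗ[ℝ] V) := by
    ext x y
    rw [contract_comp]
    rfl
  rw [this, LinearMap.range_comp, LinearMap.range_comp_of_range_eq_top _ (LinearEquiv.range _)]
  exact LinearEquiv.finrank_map_eq _ _

end Naturality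

/-! ### Permuting the arguments of the complex extension. -/

section Perm

variable {V : Type*} [AddCommGroup V] [Module ℝ V] [TopologicalSpace V]

theorem complexEval_comp_perm {k : ℕ} (α : V [⋀^Fin k]→L[ℝ] ℂ) (x y : Fin k → V)
    (τ : Equiv.Perm (Fin k)) :
    complexEval α (x ∘ τ) (y ∘ τ) = Equiv.Perm.sign τ • complexEval α x y := by
  rw [complexEval, complexEval, Finset.smul_sum]
  refine Fintype.sum_equiv τ.finsetCongr _ _ fun S => ?_
  have h : (fun j => if j ∈ S then (y ∘ τ) j else (x ∘ τ) j) =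
      (fun j => if j ∈ τ.finsetCongr S then y j else x j) ∘ τ := by
    ext j; simp
  have h' := α.toAlternatingMap.map_perm
    (fun j => if j ∈ τ.finsetCongr S then y j else x j) τ
  rw [← h] at h'
  change α _ = Equiv.Perm.sign τ • α _ at h'
  rw [h']
  simp only [Equiv.finsetCongr_apply, Finset.card_map]
  rw [mul_smul_comm]

end Perm

/-! ### First derivatives of `Θ` and the type of `dρ̃` in a chart. -/

section Local

variable {E : Type*} [NormedAddCommGroup E] [NormedSpace ℝ E]

/-- The directional derivative `(D_u ρ) (a, b, c)`. -/
def dContract (ρ : E → E [⋀^Fin 3]→L[ℝ] ℝ) (p u a b c : E) : ℝ :=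
  fderiv ℝ (fun q => contract (ρ q) a b c) p u

theorem differentiableAt_contract {ρ : E → E [⋀^Fin 3]→L[ℝ] ℝ} {p : E}
    (hρ : DifferentiableAt ℝ ρ p) (a b c : E) :
    DifferentiableAt ℝ (fun q => contract (ρ q) a b c) p := by
  simp only [contract_apply]
  fun_prop

theorem extDeriv_eq_dContract {ρ : E → E [⋀^Fin 3]→L[ℝ] ℝ} {p : E}
    (hρ : DifferentiableAt ℝ ρ p) (a b c d : E) :
    extDeriv ρ p ![a, b, c, d] = dContract ρ p a b c d - dContract ρ p b a c d
      + dContract ρ p c a b d - dContract ρ p d a b c := by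
  have hα : ∀ f : Fin 3 → E, ∀ q, ρ q f = contract (ρ q) (f 0) (f 1) (f 2) := fun f q => by
    rw [contract_apply]; congr 1; ext i; fin_cases i <;> rfl
  rw [extDeriv_apply hρ]
  simp only [hα, Fin.sum_univ_succ]
  simp [Fin.removeNth, Fin.succAbove, dContract]
  ring

theorem dContract_swap (ρ : E → E [⋀^Fin 3]→L[ℝ] ℝ) (p u a b c : E) :
    dContract ρ p u a b c = -dContract ρ p u a c b := by
  have : (fun q => contract (ρ q) a b c) = -fun q => contract (ρ q) a c b :=
    funext fun q => contract_swap _ _ _ _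
  rw [dContract, this, fderiv_neg]
  rfl

theorem dContract_swap_left (ρ : E → E [⋀^Fin 3]→L[ℝ] ℝ) (p u a b c : E) :
    dContract ρ p u a b c = -dContract ρ p u b a c := by
  have : (fun q => contract (ρ q) a b c) = -fun q => contract (ρ q) b a c :=
    funext fun q => contract_swap_left _ _ _ _
  rw [dContract, this, fderiv_neg]
  rfl

theorem dContract_neg_left (ρ : E → E [⋀^Fin 3]→L[ℝ] ℝ) (p u a b c : E) :
    dContract ρ p u (-a) b c = -dContract ρ p u a b c := by
  have : (fun q => contract (ρ q) (-a) b c) = -fun q => contract (ρ q) a b c :=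
    funext fun q => by simp [contract_neg]
  rw [dContract, this, fderiv_neg]
  rfl

/-- Both `f` and `g` are `O(q - p)` and `ρ` is bounded near `p`, so the expression is `O(|q - p|²)`.
-/
theorem hasFDerivAt_contract_of_eq_zero {ρ : E → E [⋀^Fin 3]→L[ℝ] ℝ} {p : E}
    (hρ : ContinuousAt ρ p) {f g : E → E} (hf : DifferentiableAt ℝ f p)
    (hg : DifferentiableAt ℝ g p) (hf0 : f p = 0) (hg0 : g p = 0) (z : E) :
    HasFDerivAt (fun q => contract (ρ q) (f q) (g q) z) (0 : E →L[ℝ] ℝ) p := by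
  refine Asymptotics.IsBigO.hasFDerivAt (n := 2) ?_ (by norm_num)
  have h1 : ρ =O[𝓝 p] fun _ => (1 : ℝ) := hρ.isBigO_one ℝ
  have h2 : f =O[𝓝 p] fun q => q - p := by simpa [hf0] using hf.isBigO_sub
  have h3 : g =O[𝓝 p] fun q => q - p := by simpa [hg0] using hg.isBigO_sub
  have h4 : (fun q => contract (ρ q) (f q) (g q) z) =O[𝓝 p]
      fun q => ‖ρ q‖ * (‖f q‖ * ‖g q‖ * ‖z‖) := by
    refine Asymptotics.IsBigO.of_bound 1 (Filter.Eventually.of_forall fun q => ?_)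
    have := (ρ q).le_opNorm ![f q, g q, z]
    rw [Fin.prod_univ_three] at this
    rw [one_mul, Real.norm_of_nonneg (r := _ * _) (by positivity)]
    exact this
  refine h4.trans ?_
  have h5 := h1.norm_left.mul ((h2.norm_left.norm_right.mul h3.norm_left.norm_right).mul
    (Asymptotics.isBigO_refl (fun _ : E => ‖z‖) (𝓝 p)))
  refine h5.trans ?_
  refine Asymptotics.IsBigO.of_bound ‖z‖ (Filter.Eventually.of_forall fun q => le_of_eq ?_)
  simp only [norm_mul, norm_norm, norm_one, norm_pow]
  ring

/-- A family of forms `ρ`, `σ` and complex structures `J` such that `ρ + i σ` has type `(3, 0)` with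
respect to `J` near `p`. -/
structure IsConjugateFamily (ρ σ : E → E [⋀^Fin 3]→L[ℝ] ℝ) (J : E → E →ₗ[ℝ] E) (p : E) :
    Prop where
  diff_left : DifferentiableAt ℝ ρ p
  diff_right : DifferentiableAt ℝ σ p
  diff_structure : ∀ x, DifferentiableAt ℝ (fun q => J q x) p
  sq : ∀ᶠ q in 𝓝 p, ∀ v, J q (J q v) = -v
  symm : ∀ᶠ q in 𝓝 p, ∀ x y z, contract (ρ q) (J q x) y z = contract (ρ q) x (J q y) z
  conj : ∀ᶠ q in 𝓝 p, ∀ x y z, contract (σ q) x y z = -contract (ρ q) (J q x) y z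

variable {ρ σ : E → E [⋀^Fin 3]→L[ℝ] ℝ} {J : E → E →ₗ[ℝ] E} {p : E}

/-- This is the real part of `D_u Θ(x + iJ_p x, y + iJ_p y, z) = 0`. Since `x + iJ_q x` annihilates
`Θ_q`, each argument may be replaced by its error `i(J_p - J_q)x`; the product of two such errors
has zero derivative at `p`. -/
theorem IsConjugateFamily.dContract_eq (h : IsConjugateFamily ρ σ J p) (u x y z : E) :
    dContract ρ p u x y z - dContract σ p u (J p x) y z - dContract σ p u x (J p y) z
      - dContract ρ p u (J p x) (J p y) z = 0 := by
  have hR := fun a b c => (differentiableAt_contract h.diff_left a b c).hasFDerivAt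
  have hS := fun a b c => (differentiableAt_contract h.diff_right a b c).hasFDerivAt
  have h1 := (((hR x y z).sub (hS (J p x) y z)).sub (hS x (J p y) z)).sub (hR (J p x) (J p y) z)
  have h2 := (hasFDerivAt_contract_of_eq_zero (f := fun q => J p x - J q x)
    (g := fun q => J p y - J q y) h.diff_left.continuousAt
    ((differentiableAt_const _).sub (h.diff_structure x))
    ((differentiableAt_const _).sub (h.diff_structure y)) (sub_self _) (sub_self _) z).neg
  have h3 := h2.congr_of_eventuallyEq (f₁ := fun q => contract (ρ q) x y z
      - contract (σ q) (J p x) y z - contract (σ q) x (J p y) z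
      - contract (ρ q) (J p x) (J p y) z) (by
    filter_upwards [h.sq, h.symm, h.conj] with q h1 h2 h3
    simp only [Pi.neg_apply]
    rw [h3, h3, h2, h2 x]
    simp only [contract_sub, map_sub, LinearMap.sub_apply]
    rw [h2 x (J p y), h2 x (J q y), h1]
    simp only [map_neg, LinearMap.neg_apply]
    ring)
  have h4 := h1.unique h3
  simpa [dContract] using congrArg (fun g : E →L[ℝ] ℝ => g u) h4

/-- Complex conjugation: `ρ - iσ` has type `(3,0)` for `-J`. It exchanges the roles of `(1,0)` and
`(0,1)` vectors. -/
theorem IsConjugateFamily.neg (h : IsConjugateFamily ρ σ J p) :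
    IsConjugateFamily ρ (fun q => -σ q) (fun q => -J q) p where
  diff_left := h.diff_left
  diff_right := h.diff_right.neg
  diff_structure x := (h.diff_structure x).neg
  sq := h.sq.mono fun q hq v => by simp [hq]
  symm := h.symm.mono fun q hq x y z => by simp [contract_neg, hq]
  conj := h.conj.mono fun q hq x y z => by
    have : contract (-σ q) x y z = -contract (σ q) x y z := rfl
    rw [this, hq]
    simp [contract_neg]

/-- The extension of `dσ` vanishes when three of its arguments are of type `(0, 1)`; here the
remaining argument is the first one. -/
theorem IsConjugateFamily.complexEval_extDeriv_eq_zero_of_succ (h : IsConjugateFamily ρ σ J p)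
    (hd : extDeriv ρ p = 0) (x y : Fin 4 → E) (hy : ∀ j, j ≠ 0 → y j = J p (x j)) :
    complexEval (complexify (extDeriv σ p)) x y = 0 := by
  -- `D u a b c` is the derivative `D_u Θ(a, b, c)`, made opaque for the final linear algebra.
  obtain ⟨D, hD⟩ : ∃ D : E → E → E → E → ℂ, ∀ u a b c, D u a b c =
      dContract ρ p u a b c + Complex.I * dContract σ p u a b c := ⟨_, fun _ _ _ _ => rfl⟩
  have hJ := h.sq.self_of_nhds
  have hI := Complex.I_sq
  -- Replacing `a` by `J_p a` in the real part yields the imaginary part of the same identity.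
  have H : ∀ u a b c, D u a b c + Complex.I * D u (J p a) b c + Complex.I * D u a (J p b) c
      - D u (J p a) (J p b) c = 0 := fun u a b c => by
    have h1 := h.dContract_eq u a b c
    have h2 := h.dContract_eq u (J p a) b c
    rw [hJ, dContract_neg_left, dContract_neg_left] at h2
    have h1' := congrArg (fun t : ℝ => (t : ℂ)) h1
    have h2' := congrArg (fun t : ℝ => (t : ℂ)) h2
    push_cast at h1' h2'
    simp only [hD]
    linear_combination h1' + Complex.I * h2' +
      (dContract σ p u (J p a) b c + dContract σ p u a (J p b) c) * hI
  have H' : ∀ u a b c, D u a b c + Complex.I * D u a (J p b) c + Complex.I * D u a b (J p c)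
      - D u a (J p b) (J p c) = 0 := fun u a b c => by
    have rot : ∀ a b c, D u a b c = D u b c a := fun a b c => by
      simp only [hD]
      rw [dContract_swap_left, dContract_swap, dContract_swap_left σ, dContract_swap σ]
      push_cast; ring
    have := H u b c a
    rw [rot a b c, rot a (J p b) c, rot a b (J p c), rot a (J p b) (J p c)]
    exact this
  have mulI : ∀ t₁ t₂ t₃ t₄ : ℂ, t₁ + Complex.I * t₂ + Complex.I * t₃ - t₄ = 0 →
      Complex.I * t₁ - t₂ - t₃ - Complex.I * t₄ = 0 := fun t₁ t₂ t₃ t₄ ht => by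
    linear_combination Complex.I * ht - (t₂ + t₃) * hI
  have HI := fun u a b c => mulI _ _ _ _ (H u a b c)
  have HI' := fun u a b c => mulI _ _ _ _ (H' u a b c)
  -- Since `dρ = 0`, `dΘ = i dσ`, that is `dσ = -i dΘ`.
  have hG : ∀ a b c d, complexify (extDeriv σ p) ![a, b, c, d] =
      -Complex.I * (D a b c d - D b a c d + D c a b d - D d a b c) := fun a b c d => by
    have h1 := extDeriv_eq_dContract h.diff_left a b c d
    have h2 := extDeriv_eq_dContract h.diff_right a b c d
    rw [hd, show (0 : E [⋀^Fin 4]→L[ℝ] ℝ) ![a, b, c, d] = 0 from rfl] at h1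
    have h1' := congrArg (fun t : ℝ => (t : ℂ)) h1
    push_cast at h1'
    rw [complexify_apply, h2]
    simp only [hD]
    push_cast
    linear_combination -Complex.I * h1' + (dContract σ p a b c d - dContract σ p b a c d
      + dContract σ p c a b d - dContract σ p d a b c) * hI
  rw [complexEval_four]
  simp only [hG]
  rw [hy 1 (by decide), hy 2 (by decide), hy 3 (by decide)]
  generalize x 0 = x₀, x 1 = x₁, x 2 = x₂, x 3 = x₃, y 0 = y₀
  -- One line for each choice of differentiating direction. Two of the remaining `(0,1)` arguments
  -- fill the identity: the first two slots of `Θ` if the direction is the exceptional vector, the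
  -- last two otherwise. The four summands expand the direction and the leftover argument.
  linear_combination (-Complex.I) * (
    (H x₀ x₁ x₂ x₃ + HI x₀ x₁ x₂ (J p x₃) + HI y₀ x₁ x₂ x₃ - H y₀ x₁ x₂ (J p x₃))
    - (H' x₁ x₀ x₂ x₃ + HI' (J p x₁) x₀ x₂ x₃ + HI' x₁ y₀ x₂ x₃ - H' (J p x₁) y₀ x₂ x₃)
    + (H' x₂ x₀ x₁ x₃ + HI' (J p x₂) x₀ x₁ x₃ + HI' x₂ y₀ x₁ x₃ - H' (J p x₂) y₀ x₁ x₃)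
    - (H' x₃ x₀ x₁ x₂ + HI' (J p x₃) x₀ x₁ x₂ + HI' x₃ y₀ x₁ x₂ - H' (J p x₃) y₀ x₁ x₂))

theorem IsConjugateFamily.complexEval_extDeriv_eq_zero (h : IsConjugateFamily ρ σ J p)
    (hd : extDeriv ρ p = 0) (k : Fin 4) (x y : Fin 4 → E) (hy : ∀ j, j ≠ k → y j = J p (x j)) :
    complexEval (complexify (extDeriv σ p)) x y = 0 := by
  -- A transposition brings the exceptional argument to the first place, at the cost of a sign.
  have h1 := h.complexEval_extDeriv_eq_zero_of_succ hd (x ∘ Equiv.swap 0 k) (y ∘ Equiv.swap 0 k)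
    fun j hj => hy _ fun hk => hj <| by
      exact (Equiv.swap 0 k).injective (hk.trans (Equiv.swap_apply_left 0 k).symm)
  rwa [complexEval_comp_perm, smul_eq_zero_iff_eq] at h1

theorem complexEval_neg {k : ℕ} (α : E [⋀^Fin k]→L[ℝ] ℂ) (x y : Fin k → E) :
    complexEval (-α) x y = -complexEval α x y := by
  simp [complexEval]

theorem IsConjugateFamily.isOfType_extDeriv (h : IsConjugateFamily ρ σ J p)
    (hd : extDeriv ρ p = 0) : IsOfType 2 2 (J p) (complexify (extDeriv σ p)) := by
  refine ⟨rfl, fun x S hS => ?_⟩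
  have hsub : ∀ T : Finset (Fin 4), T.card ≤ 1 → ∃ k, ∀ j, j ≠ k → j ∉ T := fun T hT => by
    obtain ⟨k, hk⟩ := Finset.card_le_one_iff_subset_singleton.1 hT
    exact ⟨k, fun j hj hjT => hj (Finset.mem_singleton.1 (hk hjT))⟩
  -- Fewer than two `(1,0)` arguments leave at least three of type `(0,1)`; more than two is the
  -- conjugate situation.
  rcases lt_or_gt_of_ne hS with hS | hS
  · obtain ⟨k, hk⟩ := hsub S (by omega)
    exact h.complexEval_extDeriv_eq_zero hd k x _ fun j hj => if_neg (hk j hj)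
  · obtain ⟨k, hk⟩ := hsub Sᶜ (by rw [Finset.card_compl, Fintype.card_fin]; omega)
    have h1 := h.neg.complexEval_extDeriv_eq_zero hd k x
      (fun j => if j ∈ S then -J p (x j) else J p (x j)) fun j hj => by
        have hjS : j ∈ S := by simpa using hk j hj
        simp [hjS]
    have h2 : complexify (extDeriv (fun q => -σ q) p) = -complexify (extDeriv σ p) := by
      ext m
      have : extDeriv (fun q => -σ q) p m = -extDeriv σ p m := by
        rw [extDeriv_apply h.diff_right.fun_neg, extDeriv_apply h.diff_right]
        simp [fderiv_fun_neg]
      rw [complexify_apply, this]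
      simp [complexify_apply]
    rwa [h2, complexEval_neg, neg_eq_zero] at h1

end Local

/-! ### Smooth dependence of `I_ρ` and `ρ̃` on `ρ`. -/

section Smooth

variable {X E : Type*} [NormedAddCommGroup X] [NormedSpace ℝ X] [NormedAddCommGroup E]
  [NormedSpace ℝ E]

/-- Evaluation on tuples of basis vectors embeds the space of forms linearly in a coordinate space,
and a linear left inverse recovers the form from its components. -/
theorem contDiffAt_of_forall_apply [FiniteDimensional ℝ E] {k : ℕ} {n : WithTop ℕ∞}
    {g : X → E [⋀^Fin k]→L[ℝ] ℝ} {p : X}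
    (h : ∀ m : Fin k → E, ContDiffAt ℝ n (fun q => g q m) p) : ContDiffAt ℝ n g p := by
  let b := Module.finBasis ℝ E
  let T : (E [⋀^Fin k]→L[ℝ] ℝ) →ₗ[ℝ] ((Fin k → Fin (Module.finrank ℝ E)) → ℝ) :=
    { toFun := fun α f => α fun i => b (f i)
      map_add' := fun _ _ => rfl
      map_smul' := fun _ _ => rfl }
  have hT : LinearMap.ker T = ⊥ := by
    refine LinearMap.ker_eq_bot'.2 fun α hα => ?_
    apply ContinuousAlternatingMap.toAlternatingMap_injective
    exact Module.Basis.ext_alternating b fun f _ => congrFun hα f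
  obtain ⟨L, hL⟩ := T.exists_leftInverse_of_injective hT
  have hg : g = fun q => L.toContinuousLinearMap (T (g q)) := funext fun q =>
    (congrArg (fun A : (E [⋀^Fin k]→L[ℝ] ℝ) →ₗ[ℝ] (E [⋀^Fin k]→L[ℝ] ℝ) => A (g q)) hL).symm
  rw [hg]
  exact L.toContinuousLinearMap.contDiff.contDiffAt.comp p
    (contDiffAt_pi.2 fun f => h fun i => b (f i))

theorem contDiffAt_linearMap_apply {ι F : Type*} [Fintype ι] [NormedAddCommGroup F]
    [NormedSpace ℝ F] (e : Module.Basis ι ℝ E) {n : WithTop ℕ∞} {A : X → E →ₗ[ℝ] F} {w : X → E}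
    {p : X} (hA : ∀ v, ContDiffAt ℝ n (fun q => A q v) p) (hw : ContDiffAt ℝ n w p) :
    ContDiffAt ℝ n (fun q => A q (w q)) p := by
  have : FiniteDimensional ℝ E := .of_basis e
  have h : (fun q => A q (w q)) =
      fun q => ∑ i, (e.coord i).toContinuousLinearMap (w q) • A q (e i) := funext fun q => by
    conv_lhs => rw [← e.sum_repr (w q)]
    simp only [map_sum, map_smul]
    rfl
  rw [h]
  exact ContDiffAt.sum fun i _ =>
    ((e.coord i).toContinuousLinearMap.contDiff.contDiffAt.comp p hw).smul (hA _)

variable {ρ : X → E [⋀^Fin 3]→L[ℝ] ℝ} {n : WithTop ℕ∞} {p : X}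

theorem contDiffAt_alternating_apply {k : ℕ} {g : X → E [⋀^Fin k]→L[ℝ] ℝ}
    (hg : ContDiffAt ℝ n g p) (m : Fin k → E) : ContDiffAt ℝ n (fun q => g q m) p :=
  (ContinuousAlternatingMap.apply ℝ E ℝ m).contDiff.contDiffAt.comp p hg

theorem contDiffAt_hitchinMap (hρ : ContDiffAt ℝ n ρ p) (e : Module.Basis (Fin 6) ℝ E) (v : E) :
    ContDiffAt ℝ n (fun q => hitchinMap e (ρ q) v) p := by
  simp only [hitchinMap_apply, contractWedge_apply]
  refine ContDiffAt.sum fun i _ => ContDiffAt.smul (contDiffAt_const.mul ?_) contDiffAt_const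
  refine ContDiffAt.sum fun j _ => contDiffAt_const.mul ?_
  refine ContDiffAt.sum fun l _ => contDiffAt_const.mul ?_
  exact (contDiffAt_alternating_apply hρ _).mul (contDiffAt_alternating_apply hρ _)

theorem contDiffAt_hitchinScale (hρ : ContDiffAt ℝ n ρ p) (e : Module.Basis (Fin 6) ℝ E) :
    ContDiffAt ℝ n (fun q => hitchinScale e (ρ q)) p := by
  have : FiniteDimensional ℝ E := .of_basis e
  exact ((e.coord 0).toContinuousLinearMap.contDiff.contDiffAt.comp p
    (contDiffAt_linearMap_apply e (contDiffAt_hitchinMap hρ e)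
      (contDiffAt_hitchinMap hρ e (e 0)))).neg

/-- `K` and the scale are polynomial in `ρ`; definiteness at `p` alone keeps the scale away from
zero, where the square root and the inverse are smooth. -/
theorem contDiffAt_turn (hρ : ContDiffAt ℝ n ρ p) (hp : IsDefinite (ρ p))
    (e : Module.Basis (Fin 6) ℝ E) (v : E) :
    ContDiffAt ℝ n (fun q => turn e (ρ q) v) p := by
  simp only [turn_apply]
  have hpos := hitchinScale_pos hp e
  exact (((contDiffAt_hitchinScale hρ e).sqrt hpos.ne').inv (Real.sqrt_pos.2 hpos).ne').neg.smul
    (contDiffAt_hitchinMap hρ e v)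

theorem contDiffAt_contract_turn (hρ : ContDiffAt ℝ n ρ p) (hp : IsDefinite (ρ p))
    (e : Module.Basis (Fin 6) ℝ E) (x y z : E) :
    ContDiffAt ℝ n (fun q => contract (ρ q) (turn e (ρ q) x) y z) p := by
  refine contDiffAt_linearMap_apply e
    (A := fun q => (contractₗ (ρ q)).flip y |>.flip z) (fun v => ?_) (contDiffAt_turn hρ hp e x)
  exact contDiffAt_alternating_apply hρ ![v, y, z]

end Smooth

/-! ### Stability of the orientation of a moving basis. -/

section Orientation

theorem eventually_orientation_eq {X E : Type*} [TopologicalSpace X] [NormedAddCommGroup E]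
    [NormedSpace ℝ E] (e : Module.Basis (Fin 6) ℝ E) {M : X → E →L[ℝ] E} {p : X}
    (hM : ContinuousAt M p) (o : Orientation ℝ E (Fin 6))
    (B : Module.Basis (Fin 6) ℝ E) (hB : ⇑B = M p ∘ e) (hBo : B.orientation = o) :
    ∀ᶠ q in 𝓝 p, ∀ B' : Module.Basis (Fin 6) ℝ E, ⇑B' = M q ∘ e → B'.orientation = o := by
  have : FiniteDimensional ℝ E := .of_basis e
  have hcont : ContinuousAt (fun q => B.det (M q ∘ e)) p := by
    obtain ⟨F, hF⟩ : ∃ F : X → Matrix (Fin 6) (Fin 6) ℝ, ∀ q i j, F q i j =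
        (B.coord i).toContinuousLinearMap (M q (e j)) := ⟨_, fun _ _ _ => rfl⟩
    have hFc : ContinuousAt F p := continuousAt_pi.2 fun i => continuousAt_pi.2 fun j => by
      simp only [hF]
      exact ((B.coord i).toContinuousLinearMap.continuous.continuousAt).comp
        (f := fun q => M q (e j)) (hM.clm_apply continuousAt_const)
    have h : (fun q => B.det (M q ∘ e)) = Matrix.det ∘ F := by
      ext q
      rw [Module.Basis.det_apply, Function.comp_apply]
      congr 1
      ext i j
      rw [hF]
      rfl
    have hd : Continuous (Matrix.det : Matrix (Fin 6) (Fin 6) ℝ → ℝ) := continuous_id.matrix_det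
    rw [h]
    exact hd.continuousAt.comp hFc
  have hpos : 0 < B.det (M p ∘ e) := by
    rw [← hB, B.det_self]; exact one_pos
  filter_upwards [hcont.eventually (lt_mem_nhds hpos)] with q hq B' hB'
  rw [← hBo]
  refine ((B.orientation_eq_iff_det_pos B').2 ?_).symm
  rwa [hB']

end Orientation

/-! ### Charts and oriented frames on the manifold. -/

section Manifold

variable {N : Type*} [TopologicalSpace N] [ChartedSpace R6 N] [IsManifold (𝓡 6) ∞ N]

instance isManifold_one : IsManifold (𝓡 6) 1 N := IsManifold.of_le (n := ∞) (by simp)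

/-- The derivative of the inverse of the preferred chart at `x₀`. -/
def chartSymmDeriv (x₀ : N) (y : R6) :
    R6 →L[ℝ] TangentSpace (𝓡 6) ((extChartAt (𝓡 6) x₀).symm y) :=
  mfderiv 𝓘(ℝ, R6) (𝓡 6) (extChartAt (𝓡 6) x₀).symm y

theorem isInvertible_chartSymmDeriv {x₀ : N} {y : R6} (hy : y ∈ (extChartAt (𝓡 6) x₀).target) :
    (chartSymmDeriv x₀ y).IsInvertible := by
  have h := isInvertible_mfderivWithin_extChartAt_symm (I := 𝓡 6) hy
  rw [ModelWithCorners.Boundaryless.range_eq_univ, mfderivWithin_univ] at h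
  exact h

theorem tangentCoord_apply {x₀ y : N}
    (hy : y ∈ (trivializationAt R6 (TangentSpace (𝓡 6) : N → Type _) x₀).baseSet)
    (v : TangentSpace (𝓡 6) y) :
    tangentCoord x₀ y hy v = mfderiv (𝓡 6) 𝓘(ℝ, R6) (extChartAt (𝓡 6) x₀) y v := by
  have h := TangentBundle.continuousLinearMapAt_trivializationAt (𝕜 := ℝ) (I := 𝓡 6)
    (x₀ := x₀) (x := y) (by simpa using hy)
  exact (congrFun (Bundle.Trivialization.coe_continuousLinearEquivAt_eq (R := ℝ) _ hy) v).trans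
    (DFunLike.congr_fun h v)

theorem mdifferentiableAt_chart_symm {x₀ : N} {y : R6}
    (hy : y ∈ (extChartAt (𝓡 6) x₀).target) :
    MDifferentiableAt 𝓘(ℝ, R6) (𝓡 6) (extChartAt (𝓡 6) x₀).symm y := by
  have h := mdifferentiableWithinAt_extChartAt_symm (I := 𝓡 6) hy
  rwa [ModelWithCorners.Boundaryless.range_eq_univ, mdifferentiableWithinAt_univ] at h

theorem mfderiv_comp_chartSymmDeriv {x₀ x₁ : N} {y : R6} (hy : y ∈ (extChartAt (𝓡 6) x₀).target)
    (hy' : (extChartAt (𝓡 6) x₀).symm y ∈ (extChartAt (𝓡 6) x₁).source) (v : R6) :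
    mfderiv (𝓡 6) 𝓘(ℝ, R6) (extChartAt (𝓡 6) x₁) ((extChartAt (𝓡 6) x₀).symm y)
      (chartSymmDeriv x₀ y v) =
      fderiv ℝ (extChartAt (𝓡 6) x₁ ∘ (extChartAt (𝓡 6) x₀).symm) y v := by
  rw [← mfderiv_eq_fderiv, mfderiv_comp y (I' := 𝓡 6)
    (mdifferentiableAt_extChartAt (by simpa using hy')) (mdifferentiableAt_chart_symm hy)]
  rfl

theorem continuousAt_fderiv_coord_change {x₀ x₁ : N} {y : R6}
    (hy : y ∈ (extChartAt (𝓡 6) x₀).target)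
    (hy' : (extChartAt (𝓡 6) x₀).symm y ∈ (extChartAt (𝓡 6) x₁).source) :
    ContinuousAt (fderiv ℝ (extChartAt (𝓡 6) x₁ ∘ (extChartAt (𝓡 6) x₀).symm)) y := by
  have h := contDiffWithinAt_ext_coord_change (I := 𝓡 6) (n := ∞) x₁ x₀ (y := y)
    (by simpa using ⟨by simpa using hy, by simpa using hy'⟩)
  rw [ModelWithCorners.Boundaryless.range_eq_univ, contDiffWithinAt_univ] at h
  exact h.continuousAt_fderiv (by simp)

/-- The expression of the orientation in a chart is locally constant. -/
theorem ManifoldOrientation.exists_basis (o : ManifoldOrientation N) {x₀ : N} {y₀ : R6}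
    (hy₀ : y₀ ∈ (extChartAt (𝓡 6) x₀).target) :
    ∃ e : Module.Basis (Fin 6) ℝ R6, ∀ᶠ y in 𝓝 y₀, ∃ B : Module.Basis (Fin 6) ℝ
      (TangentSpace (𝓡 6) ((extChartAt (𝓡 6) x₀).symm y)),
      (∀ i, B i = chartSymmDeriv x₀ y (e i)) ∧
        B.orientation = o.at_ ((extChartAt (𝓡 6) x₀).symm y) := by
  set φ := extChartAt (𝓡 6) x₀ with hφ
  -- The orientation is constant in the chart at `φ.symm y₀`, not in the one at `x₀`; the derivative
  -- `M` of the coordinate change relates the two.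
  obtain ⟨c, hc⟩ := o.locally_constant (φ.symm y₀)
  set x₁ := φ.symm y₀ with hx₁
  have hcont : ContinuousAt φ.symm y₀ := continuousAt_extChartAt_symm'' hy₀
  have hnear : ∀ᶠ y in 𝓝 y₀, y ∈ φ.target ∧ φ.symm y ∈ (extChartAt (𝓡 6) x₁).source := by
    refine ((isOpen_extChartAt_target x₀).mem_nhds hy₀ |> Filter.eventually_mem_set.2).and ?_
    exact hcont.eventually (extChartAt_source_mem_nhds x₁)
  have hlc := hcont.eventually hc
  let M : R6 → R6 →L[ℝ] R6 := fderiv ℝ (extChartAt (𝓡 6) x₁ ∘ φ.symm)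
  have hMc : ContinuousAt M y₀ := continuousAt_fderiv_coord_change hy₀ (mem_extChartAt_source x₁)
  have hbase : ∀ y, φ.symm y ∈ (extChartAt (𝓡 6) x₁).source → φ.symm y ∈
      (trivializationAt R6 (TangentSpace (𝓡 6) : N → Type _) x₁).baseSet := fun y hy => by
    simpa using hy
  have hchoose : ∀ y, y ∈ φ.target → φ.symm y ∈ (extChartAt (𝓡 6) x₁).source →
      ∃ A : R6 ≃ₗ[ℝ] TangentSpace (𝓡 6) (φ.symm y), (∀ v, A v = chartSymmDeriv x₀ y v) ∧
        ∃ T : TangentSpace (𝓡 6) (φ.symm y) ≃ₗ[ℝ] R6, (∀ v, T (A v) = M y v) ∧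
          ((∀ hy, Orientation.map (Fin 6) (tangentCoord x₁ (φ.symm y) hy) (o.at_ (φ.symm y)) = c) →
          Orientation.map (Fin 6) T (o.at_ (φ.symm y)) = c) := by
    intro y hy hy'
    obtain ⟨A, hA⟩ := isInvertible_chartSymmDeriv hy
    refine ⟨A.toLinearEquiv, fun v => by rw [← hA]; rfl, tangentCoord x₁ _ (hbase y hy'),
      fun v => ?_, fun h => h _⟩
    rw [tangentCoord_apply, ← mfderiv_comp_chartSymmDeriv hy hy', ← hA]
    rfl
  obtain ⟨A₀, hA₀, T₀, hT₀, hc₀⟩ := hchoose y₀ hy₀ (mem_extChartAt_source x₁)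
  let b : Module.Basis (Fin 6) ℝ R6 := (EuclideanSpace.basisFun (Fin 6) ℝ).toBasis
  let B₀ := b.adjustToOrientation c
  -- Since `T₀ ∘ A₀ = M y₀`, this basis is carried by `M y₀` to `B₀`, which has orientation `c`.
  -- Continuity of `M` keeps the orientation nearby.
  let e := B₀.map (A₀.trans T₀).symm
  have hB₀ : ⇑B₀ = M y₀ ∘ e := by
    ext1 i
    simp [e, ← hT₀]
  refine ⟨e, ?_⟩
  filter_upwards [hnear, hlc, eventually_orientation_eq e hMc c B₀ hB₀
    (b.orientation_adjustToOrientation c)] with y hy hcy hor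
  obtain ⟨A, hA, T, hT, hcT⟩ := hchoose y hy.1 hy.2
  refine ⟨e.map A, fun i => by rw [← hA]; rfl, ?_⟩
  apply (Orientation.map (Fin 6) T).injective
  rw [hcT hcy, ← Module.Basis.orientation_map]
  exact hor _ (funext fun i => hT _)

end Manifold

theorem isConjugateFamily_turn {E : Type*} [NormedAddCommGroup E] [NormedSpace ℝ E]
    (e : Module.Basis (Fin 6) ℝ E) {ρ σ : E → E [⋀^Fin 3]→L[ℝ] ℝ} {p : E}
    (hρ : ContDiffAt ℝ 1 ρ p) (hσ : DifferentiableAt ℝ σ p)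
    (h : ∀ᶠ q in 𝓝 p, IsDefinite (ρ q) ∧
      ∀ a b c, contract (σ q) a b c = -contract (ρ q) (turn e (ρ q) a) b c) :
    IsConjugateFamily ρ σ (fun q => turn e (ρ q)) p where
  diff_left := hρ.differentiableAt (by simp)
  diff_right := hσ
  diff_structure v := (contDiffAt_turn hρ h.self_of_nhds.1 e v).differentiableAt (by simp)
  sq := h.mono fun _ hq => turn_turn hq.1 e
  symm := h.mono fun _ hq => contract_turn hq.1 e
  conj := h.mono fun _ hq => hq.2

/-! ### From the chart computation to the manifold. -/

section Manifold

variable {N : Type*} [TopologicalSpace N] [ChartedSpace R6 N] [IsManifold (𝓡 6) ∞ N]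

instance tangentSpace_t2Space (x : N) : T2Space (TangentSpace (𝓡 6) x) :=
  inferInstanceAs (T2Space R6)

instance tangentSpace_finiteDimensional (x : N) : FiniteDimensional ℝ (TangentSpace (𝓡 6) x) :=
  inferInstanceAs (FiniteDimensional ℝ R6)

theorem ManifoldOrientation.exists_basis_at (o : ManifoldOrientation N) (x : N) :
    ∃ e : Module.Basis (Fin 6) ℝ (TangentSpace (𝓡 6) x), e.orientation = o.at_ x := by
  have h : Fintype.card (Fin 6) = Module.finrank ℝ (TangentSpace (𝓡 6) x) :=
    (finrank_euclideanSpace (𝕜 := ℝ) (ι := Fin 6)).symm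
  exact ⟨(o.at_ x).someBasis h, (o.at_ x).someBasis_orientation h⟩

/-- Reduces the intrinsic objects, which are chosen separately at each point, to the explicit
formula for `turn` with one basis `e` of `ℝ⁶` valid throughout a neighbourhood. -/
theorem exists_local_expression (o : ManifoldOrientation N) {ρ : DForm N 3}
    (hρ : ∀ x, IsDefinite (ρ x)) {x₀ : N} {y₀ : R6} (hy₀ : y₀ ∈ (extChartAt (𝓡 6) x₀).target) :
    ∃ e : Module.Basis (Fin 6) ℝ R6, ∀ᶠ y in 𝓝 y₀, IsDefinite (DForm.inChart ρ x₀ y) ∧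
      (∀ a b c, contract (DForm.inChart (tildeForm o ρ) x₀ y) a b c =
        -contract (DForm.inChart ρ x₀ y) (turn e (DForm.inChart ρ x₀ y) a) b c) ∧
      ∀ v, almostComplexStructure o ρ ((extChartAt (𝓡 6) x₀).symm y) (chartSymmDeriv x₀ y v) =
        chartSymmDeriv x₀ y (turn e (DForm.inChart ρ x₀ y) v) := by
  obtain ⟨e, he⟩ := o.exists_basis hy₀
  refine ⟨e, ?_⟩
  filter_upwards [he, (isOpen_extChartAt_target x₀).mem_nhds hy₀] with y hB hy
  obtain ⟨B, hBe, hBo⟩ := hB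
  obtain ⟨A, hA⟩ := isInvertible_chartSymmDeriv hy
  have hchart : ∀ α : DForm N 3, DForm.inChart α x₀ y =
      (α ((extChartAt (𝓡 6) x₀).symm y)).compContinuousLinearMap (chartSymmDeriv x₀ y) :=
    fun α => rfl
  refine ⟨?_, fun a b c => ?_, fun v => ?_⟩
  · rw [hchart, ← hA]
    exact (hρ _).comp A
  · rw [hchart, hchart, contract_comp, contract_comp, ← turn_comp _ _ hBe, tildeForm, ← hBo,
      contract_conjugateForm (hρ _) B]
  · rw [hchart, ← turn_comp _ _ hBe, almostComplexStructure, ← hBo,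
      inducedComplexStructure_eq_turn (hρ _) B]

theorem isSmooth_tildeForm (o : ManifoldOrientation N) {ρ : DForm N 3}
    (hρ : ∀ x, IsDefinite (ρ x)) (hs : DForm.IsSmooth ρ) : DForm.IsSmooth (tildeForm o ρ) := by
  intro x₀ y₀ hy₀
  refine ContDiffAt.contDiffWithinAt (contDiffAt_of_forall_apply fun m => ?_)
  obtain ⟨e, he⟩ := exists_local_expression o hρ hy₀
  have hρs : ContDiffAt ℝ ∞ (DForm.inChart ρ x₀) y₀ :=
    (hs x₀).contDiffAt ((isOpen_extChartAt_target x₀).mem_nhds hy₀)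
  have hm : m = ![m 0, m 1, m 2] := by ext1 i; fin_cases i <;> rfl
  refine ((contDiffAt_contract_turn hρs he.self_of_nhds.1 e (m 0) (m 1) (m 2)).neg
    ).congr_of_eventuallyEq ?_
  filter_upwards [he] with y hy
  rw [hm]
  exact hy.2.1 _ _ _

/-- The tangent space at `x` is identified with `ℝ⁶` through the preferred chart at `x`, whose
derivative at `x` is therefore the identity. -/
theorem chartSymmDeriv_self (x : N) (v : R6) :
    chartSymmDeriv x (extChartAt (𝓡 6) x x) v = v := by
  have h := DFunLike.congr_fun (mfderivWithin_extChartAt_symm_comp_mfderiv_extChartAt' (I := 𝓡 6)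
    (mem_extChartAt_source (I := 𝓡 6) x)) v
  rw [mfderiv_extChartAt_self, ModelWithCorners.Boundaryless.range_eq_univ,
    mfderivWithin_univ] at h
  exact h

theorem d_apply {k : ℕ} (α : DForm N k) (x : N) :
    DForm.d α x = extDeriv (DForm.inChart α x) (extChartAt (𝓡 6) x x) := by
  rw [DForm.d, mfderiv_extChartAt_self]
  rfl

theorem isOfType_d_tildeForm (o : ManifoldOrientation N) {ρ : DForm N 3}
    (hρ : IsClosedSLStructure ρ) (x : N) :
    IsOfType 2 2 (almostComplexStructure o ρ x) (complexify (DForm.d (tildeForm o ρ) x)) := by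
  have hx := mem_extChartAt_target (I := 𝓡 6) x
  have hnhds := (isOpen_extChartAt_target (I := 𝓡 6) x).mem_nhds hx
  obtain ⟨e, he⟩ := exists_local_expression o hρ.definite hx
  have hρs : ContDiffAt ℝ ∞ (DForm.inChart ρ x) (extChartAt (𝓡 6) x x) :=
    (hρ.smooth x).contDiffAt hnhds
  have hσs : ContDiffAt ℝ ∞ (DForm.inChart (tildeForm o ρ) x) (extChartAt (𝓡 6) x x) :=
    (isSmooth_tildeForm o hρ.definite hρ.smooth x).contDiffAt hnhds
  have hfam := isConjugateFamily_turn e (hρs.of_le (by simp)) (hσs.differentiableAt (by simp))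
    (he.mono fun q hq => ⟨hq.1, hq.2.1⟩)
  have h := hfam.isOfType_extDeriv (by rw [← d_apply]; exact hρ.closed x)
  have hJ : ∀ v : R6, (almostComplexStructure o ρ x : R6 →ₗ[ℝ] R6) v =
      turn e (DForm.inChart ρ x (extChartAt (𝓡 6) x x)) v := fun v => by
    have h1 := he.self_of_nhds.2.2 v
    rw [chartSymmDeriv_self, chartSymmDeriv_self] at h1
    -- The two base points are equal but not definitionally so; as every tangent space is `ℝ⁶` by
    -- definition, the structures can be compared as endomorphisms of `ℝ⁶`.
    have h2 : (almostComplexStructure o ρ ((extChartAt (𝓡 6) x).symm (extChartAt (𝓡 6) x x)) :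
        R6 →ₗ[ℝ] R6) = (almostComplexStructure o ρ x : R6 →ₗ[ℝ] R6) :=
      congrArg (β := R6 →ₗ[ℝ] R6) (fun z : N => almostComplexStructure o ρ z)
        (extChartAt_to_inv (I := 𝓡 6) x)
    rw [← h2]
    exact h1
  rw [d_apply]
  have hJ' : (almostComplexStructure o ρ x : R6 →ₗ[ℝ] R6) =
      turn e (DForm.inChart ρ x (extChartAt (𝓡 6) x x)) := LinearMap.ext hJ
  rw [← hJ'] at h
  exact h

end Manifold

end SL3

end

/-- If `ρ` is a closed `SL(3, ℂ)`-structure on an oriented `6`-manifold `N`, then `dρ̃` has type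
`(2, 2)` with respect to `I_ρ`. The first two conjuncts record that the objects in this claim are
what they should be: `I_ρ` and `ρ̃` exist and are unique, `I_ρ² = -1`, and `ρ̃` is smooth. -/
theorem lemma1 {N : Type*} [TopologicalSpace N] [ChartedSpace SL3.R6 N] [IsManifold (𝓡 6) ∞ N]
    (o : SL3.ManifoldOrientation N) (ρ : SL3.DForm N 3) (hρ : SL3.IsClosedSLStructure ρ) :
    (∀ x : N,
      (∃! J, SL3.IsInducedComplexStructure (o.at_ x) (ρ x) J) ∧
      (∀ v, SL3.almostComplexStructure o ρ x (SL3.almostComplexStructure o ρ x v) = -v) ∧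
      (∃! σ, SL3.IsConjugate (SL3.almostComplexStructure o ρ x) (ρ x) σ)) ∧
    SL3.DForm.IsSmooth (SL3.tildeForm o ρ) ∧
    ∀ x : N, SL3.IsOfType 2 2 (SL3.almostComplexStructure o ρ x)
      (SL3.complexify (SL3.DForm.d (SL3.tildeForm o ρ) x)) := by
  refine ⟨fun x => ?_, SL3.isSmooth_tildeForm o hρ.definite hρ.smooth,
    SL3.isOfType_d_tildeForm o hρ⟩
  obtain ⟨e, he⟩ := o.exists_basis_at x
  have hdef := hρ.definite x
  simp only [SL3.almostComplexStructure, ← he]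
  refine ⟨SL3.existsUnique_isInducedComplexStructure hdef e, fun v => ?_,
    SL3.existsUnique_isConjugate hdef e⟩
  rw [SL3.inducedComplexStructure_eq_turn hdef e, SL3.turn_turn hdef e]
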